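/- **Smooth function classes.** Let $\mathcal C$ assign to every open $U\subseteq\mathbb R^q$, $q\ge 0$, a subalgebra $\mathcal C(U)$ of $C^\infty(U,\mathbb R)$. Assume that membership is local (if every point of $U$ has an open neighborhood $W\subseteq U$ with $f|_W\in\mathcal C(W)$, then $f\in\mathcal C(U)$) and that: - ($\mathcal C_1$) $\mathcal C(U)$ contains the restrictions to $U$ of all polynomial functions on $\mathbb R^q$; - ($\mathcal C_2$) if $V\subseteq\mathbb R^p$ is open, $\varphi=(\varphi_1,\dots,\varphi_p):U\to V$ with all $\varphi_i\in\mathcal C(U)$, and $f\in\mathcal C(V)$, then $f\circ\varphi\in\mathcal C(U)$; - ($\mathcal C_3$) if $f\in\mathcal C(U)$, then $\partial_i f\in\mathcal C(U)$ for $1\le i\le q$; - ($\mathcal C_4$) if $f\in\mathcal C(U)$ vanishes at all points of $U$ with $x_i=a_i$, then $f(x)=(x_i-a_i)h(x)$ on $U$ for some $h\in\mathcal C(U)$; - ($\mathcal C_5$) if $\varphi:U\to V$ is a map between open subsets of $\mathbb R^q$ with components in $\mathcal C(U)$ and its Jacobian matrix at $a\in U$ is invertible, then there are open neighborhoods $U'\subseteq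 U$ of $a$ and $V'\subseteq V$ of $b=\varphi(a)$ and a map $\psi:V'\to U'$ with components in $\mathcal C(V')$ such that $\psi(b)=a$ and $\varphi\circ\psi=\mathrm{id}_{V'}$. A complex-valued function, or a matrix-valued one, is said to be of class $\mathcal C$ if the real and imaginary parts of it, or of its entries, belong to $\mathcal C$. **Normal nonflatness.** Let $\tilde\Delta_k$ be the unique polynomial with $\tilde\Delta_k(\sigma_1,\dots,\sigma_n)=\Delta_k$, where $\sigma_j$ is the $j$-th elementary symmetric function of $\lambda_1,\dots,\lambda_n$ and $$\Delta_k(\lambda_1,\dots,\lambda_n)=\sum_{i_1<\dots<i_k}\ \prod_{1\le a<b\le k}(\lambda_{i_a}-\lambda_{i_b})^2 .$$ For $P(z)=z^n+\sum_{j=1}^n(-1)^ja_jz^{n-j}$ put $\tilde\Delta_k(P)=\tilde\Delta_k(a_1,\dots,a_n)$. A curve $t\mapsto P(t)$ of such polynomials with smooth coefficients is *normally nonflat* if for each $t_0\in\mathbb R$ the following holds: if $k$ is maximal such that the germ at $t_0$ of $t\mapsto\tilde\Delta_k(P(t))$ is not $0$, then $t\mapsto\tilde\Delta_k(P(t))$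 is not infinitely flat at $t_0$ (some derivative, of order $\ge0$, is nonzero at $t_0$). **Proposition.** Let $t\mapsto A(t)$, $t\in\mathbb R$, be a curve of class $\mathcal C$ of normal complex $n\times n$ matrices whose characteristic polynomial $\det(z\mathbb I-A(t))$ is normally nonflat. Then there are global $\mathcal C$-parameterizations of the eigenvalues and the eigenprojections of $A$. That is, there are an integer $s\ge0$, functions $\mu_1,\dots,\mu_s:\mathbb R\to\mathbb C$ and $P_1,\dots,P_s:\mathbb R\to\mathbb C^{n\times n}$ of class $\mathcal C$, and a surjection $\kappa:\{1,\dots,n\}\to\{1,\dots,s\}$ such that: 1. the functions $\lambda_i:=\mu_{\kappa(i)}$, $1\le i\le n$, parameterize the eigenvalues of $A$: for all $t\in\mathbb R$ and $z\in\mathbb C$ the number of $i$ with $\lambda_i(t)=z$ is the (algebraic) multiplicity of $z$ as an eigenvalue of $A(t)$; 2. the $\mu_j$ are generically distinct: every $t_0\in\mathbb R$ has a neighborhood in which $\mu_1(t),\dots,\mu_s(t)$ are pairwise distinct for all $t\ne t_0$; 3. whenever $\mu_1(t),\dots,\mu_s(t)$ are pairwise distinct, $P_j(t)$ is, for each $j$,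 the eigenprojection for $\mu_j(t)$, i.e., the orthogonal projection onto $\ker(A(t)-\mu_j(t)\mathbb I)$; 4. for all $t\in\mathbb R$, each $P_j(t)$ is an orthogonal projection with $A(t)P_j(t)=\mu_j(t)P_j(t)$, $P_i(t)P_j(t)=0$ for $i\ne j$, and $\sum_{j}P_j(t)=\mathbb I$. -/

import Mathlib

open scoped ContDiff Topology Polynomial

/-- A class `𝒞` of smooth real functions on the open subsets of the spaces `ℝ^q`, `q ≥ 0`.

`𝒞(U)` is a subalgebra of `C^∞(U, ℝ)`. Elements of `𝒞(U)` are represented by total functions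
`ℝ^q → ℝ`, of which only the values on `U` count (`congr`). -/
structure FunctionClass where
  /-- the algebra `𝒞(U)` -/
  sec : ∀ {q : ℕ}, TopologicalSpace.Opens (Fin q → ℝ) → Subalgebra ℝ ((Fin q → ℝ) → ℝ)
  /-- membership in `𝒞(U)` depends only on the restriction to `U` -/
  congr : ∀ {q : ℕ} (U : TopologicalSpace.Opens (Fin q → ℝ)) (f g : (Fin q → ℝ) → ℝ),
    f ∈ sec U → Set.EqOn f g U → g ∈ sec U
  /-- `𝒞(U) ⊆ C^∞(U)` -/
  smooth : ∀ {q : ℕ} (U : TopologicalSpace.Opens (Fin q → ℝ)) (f : (Fin q → ℝ) → ℝ),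
    f ∈ sec U → ContDiffOn ℝ ∞ f U
  /-- being of class `𝒞` is a local property -/
  locality : ∀ {q : ℕ} (U : TopologicalSpace.Opens (Fin q → ℝ)) (f : (Fin q → ℝ) → ℝ),
    (∀ x ∈ U, ∃ W : TopologicalSpace.Opens (Fin q → ℝ), x ∈ W ∧ W ≤ U ∧ f ∈ sec W) → f ∈ sec U
  /-- `𝒞` contains the restrictions of polynomial functions -/
  polynomial : ∀ {q : ℕ} (U : TopologicalSpace.Opens (Fin q → ℝ)) (p : MvPolynomial (Fin q) ℝ),
    (fun x => MvPolynomial.eval x p) ∈ sec U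
  /-- `𝒞` is closed under composition -/
  comp : ∀ {q p : ℕ} (U : TopologicalSpace.Opens (Fin q → ℝ))
    (V : TopologicalSpace.Opens (Fin p → ℝ)) (φ : (Fin q → ℝ) → (Fin p → ℝ)),
    Set.MapsTo φ U V → (∀ i, (fun x => φ x i) ∈ sec U) →
    ∀ f ∈ sec V, f ∘ φ ∈ sec U
  /-- `𝒞` is closed under derivation -/
  deriv : ∀ {q : ℕ} (U : TopologicalSpace.Opens (Fin q → ℝ)) (i : Fin q),
    ∀ f ∈ sec U, (fun x => fderiv ℝ f x (Pi.single i 1)) ∈ sec U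
  /-- `𝒞` is closed under division by a coordinate -/
  division : ∀ {q : ℕ} (U : TopologicalSpace.Opens (Fin q → ℝ)) (i : Fin q) (a : ℝ),
    ∀ f ∈ sec U, (∀ x ∈ U, x i = a → f x = 0) →
    ∃ h ∈ sec U, ∀ x ∈ U, f x = (x i - a) * h x
  /-- `𝒞` is closed under taking the inverse -/
  inverse : ∀ {q : ℕ} (U V : TopologicalSpace.Opens (Fin q → ℝ)) (φ : (Fin q → ℝ) → (Fin q → ℝ)),
    Set.MapsTo φ U V → (∀ i, (fun x => φ x i) ∈ sec U) →
    ∀ a ∈ U, IsUnit (Matrix.of fun i j : Fin q =>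
        fderiv ℝ (fun x => φ x i) a (Pi.single j 1)).det →
    ∃ (U' V' : TopologicalSpace.Opens (Fin q → ℝ)) (ψ : (Fin q → ℝ) → (Fin q → ℝ)),
      a ∈ U' ∧ U' ≤ U ∧ φ a ∈ V' ∧ V' ≤ V ∧ Set.MapsTo ψ V' U' ∧
      (∀ i, (fun y => ψ y i) ∈ sec V') ∧ ψ (φ a) = a ∧ ∀ y ∈ V', φ (ψ y) = y

/-- `f ∈ 𝒞(ℝ, ℂ)`: real and imaginary part belong to `𝒞(ℝ)`, where `ℝ = ℝ^1`. -/
def FunctionClass.MemCurve (C : FunctionClass) (f : ℝ → ℂ) : Prop :=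
  (fun x : Fin 1 → ℝ => (f (x 0)).re) ∈ C.sec ⊤ ∧ (fun x : Fin 1 → ℝ => (f (x 0)).im) ∈ C.sec ⊤

/-- A curve of complex matrices is of class `𝒞` if all its entries are. -/
def FunctionClass.MemMatrixCurve (C : FunctionClass) {n : ℕ}
    (A : ℝ → Matrix (Fin n) (Fin n) ℂ) : Prop :=
  ∀ i j, C.MemCurve fun t => A t i j

/-- The polynomial
`Δ_k = ∑_{i_1 < ⋯ < i_k} ∏_{a < b} (X_{i_a} - X_{i_b})^2` in `n` variables. -/
noncomputable def rootDelta (n k : ℕ) : MvPolynomial (Fin n) ℂ :=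
  ∑ s ∈ Finset.powersetCard k (Finset.univ : Finset (Fin n)),
    ∏ p ∈ (s ×ˢ s).filter (fun p => p.1 < p.2), (MvPolynomial.X p.1 - MvPolynomial.X p.2) ^ 2

theorem rootDelta_isSymmetric (n k : ℕ) : (rootDelta n k).IsSymmetric := by
  intro e
  have key : ∀ s : Finset (Fin n),
      ∏ p ∈ (s ×ˢ s).filter (fun p => p.1 < p.2),
        ((MvPolynomial.X (e p.1) - MvPolynomial.X (e p.2)) ^ 2 : MvPolynomial (Fin n) ℂ) =
      ∏ p ∈ ((s.map e.toEmbedding) ×ˢ (s.map e.toEmbedding)).filter (fun p => p.1 < p.2),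
        (MvPolynomial.X p.1 - MvPolynomial.X p.2) ^ 2 := by
    intro s
    refine Finset.prod_bij'
      (fun p _ => if e p.1 < e p.2 then (e p.1, e p.2) else (e p.2, e p.1))
      (fun p _ => if e.symm p.1 < e.symm p.2 then (e.symm p.1, e.symm p.2)
        else (e.symm p.2, e.symm p.1)) ?_ ?_ ?_ ?_ ?_
    · rintro ⟨a, b⟩ h
      simp only [Finset.mem_filter, Finset.mem_product] at h
      have hne : e a ≠ e b := fun h' => h.2.ne (e.injective h')
      by_cases hlt : e a < e b
      · simp [hlt, h.1]
      · simp [hlt, h.1, lt_of_le_of_ne (not_lt.mp hlt) hne.symm]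
    · rintro ⟨a, b⟩ h
      simp only [Finset.mem_filter, Finset.mem_product, Finset.mem_map_equiv] at h
      have hne : e.symm a ≠ e.symm b := fun h' => h.2.ne (e.symm.injective h')
      by_cases hlt : e.symm a < e.symm b
      · simp [hlt, h.1]
      · simp [hlt, h.1, lt_of_le_of_ne (not_lt.mp hlt) hne.symm]
    · rintro ⟨a, b⟩ h
      simp only [Finset.mem_filter, Finset.mem_product] at h
      by_cases hlt : e a < e b
      · simp [hlt, h.2]
      · simp [hlt, h.2.le.not_gt]
    · rintro ⟨a, b⟩ h
      simp only [Finset.mem_filter, Finset.mem_product] at h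
      by_cases hlt : e.symm a < e.symm b
      · simp [hlt, h.2]
      · simp [hlt, h.2.le.not_gt]
    · rintro ⟨a, b⟩ h
      by_cases hlt : e a < e b
      · simp [hlt]
      · simp only [hlt, if_false]
        ring
  simp only [rootDelta, map_sum, map_prod, map_pow, map_sub, MvPolynomial.rename_X, key]
  refine Finset.sum_bij' (fun s _ => s.map e.toEmbedding) (fun s _ => s.map e.symm.toEmbedding)
    ?_ ?_ ?_ ?_ ?_
  · intro s h
    simpa [Finset.mem_powersetCard] using h
  · intro s h
    simpa [Finset.mem_powersetCard] using h
  · intro s _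
    ext x
    simp
  · intro s _
    ext x
    simp
  · intro s _
    rfl

/-- The unique polynomial `Δ̃_k` with `Δ_k = Δ̃_k(σ_1, …, σ_n)`, where `σ_j` is the `j`-th elementary
symmetric polynomial; the variable with index `i : Fin n` stands for `σ_{i+1}`. -/
noncomputable def rootDeltaTilde (n k : ℕ) : MvPolynomial (Fin n) ℂ :=
  (MvPolynomial.esymmAlgEquiv (Fin n) ℂ (Fintype.card_fin n)).symm
    ⟨rootDelta n k, rootDelta_isSymmetric n k⟩

/-- `Δ̃_k(P)` for `P = z^n + ∑_{j=1}^n (-1)^j a_j z^{n-j}`: the value of `Δ̃_k` at `(a_1, …, a_n)`. -/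
noncomputable def deltaTilde (n k : ℕ) (P : ℂ[X]) : ℂ :=
  MvPolynomial.eval (fun i : Fin n => (-1) ^ ((i : ℕ) + 1) * P.coeff (n - ((i : ℕ) + 1)))
    (rootDeltaTilde n k)

/-- The curve `P` of monic polynomials of degree `n` is normally nonflat at `t₀`: if `k` is maximal
such that the germ at `t₀` of `t ↦ Δ̃_k(P(t))` is not `0`, then this germ is not infinitely flat. -/
def IsNormallyNonflatAt (n : ℕ) (P : ℝ → ℂ[X]) (t₀ : ℝ) : Prop :=
  ∀ k : ℕ, IsGreatest {l : ℕ | ¬ ∀ᶠ t in 𝓝 t₀, deltaTilde n l (P t) = 0} k →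
    ∃ m : ℕ, iteratedDeriv m (fun t => deltaTilde n k (P t)) t₀ ≠ 0

/-- The curve `P` of monic polynomials of degree `n` is normally nonflat. -/
def IsNormallyNonflat (n : ℕ) (P : ℝ → ℂ[X]) : Prop :=
  ∀ t₀ : ℝ, IsNormallyNonflatAt n P t₀

/-- The functions `lam i` parameterize the eigenvalues of `A`: for all `t` and `z`, the number of
indices `i` with `lam i t = z` is the multiplicity of `z` as an eigenvalue of `A t`. -/
def ParameterizesEigenvalues {n : ℕ} (A : ℝ → Matrix (Fin n) (Fin n) ℂ)
    (lam : Fin n → ℝ → ℂ) : Prop :=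
  ∀ (t : ℝ) (z : ℂ), Nat.card {i : Fin n // lam i t = z} = (A t).charpoly.rootMultiplicity z

/-- `Q` is an orthogonal projection. -/
def IsOrthProj {n : ℕ} (Q : Matrix (Fin n) (Fin n) ℂ) : Prop :=
  Q * Q = Q ∧ Q.conjTranspose = Q

/-- `Q` is the eigenprojection of the normal matrix `B` for `z`: the orthogonal projection onto the
eigenspace `ker (B - z)`. -/
def IsEigenprojection {n : ℕ} (B : Matrix (Fin n) (Fin n) ℂ) (z : ℂ)
    (Q : Matrix (Fin n) (Fin n) ℂ) : Prop :=
  IsOrthProj Q ∧ ∀ v : Fin n → ℂ, Q.mulVec v = v ↔ B.mulVec v = z • v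

/-!
The eigenvalues and eigenprojections are constructed near each point `t₀` by splitting `ℂ^n` into
smaller and smaller invariant subspaces, and the local solutions are then continued along the line.

*Splitting.* Start from the trivial splitting, with the single projection `1`. Suppose that `Q` is
one of the projections of a splitting and that `B = A Q - l Q`, with `l = tr (A Q) / tr Q`, is not
the zero germ. Whenever `B t ≠ 0`, some two distinct eigenvalues of `A t` have distance at most
`2 ‖B t‖` (`exists_roots_norm_sub_le`). If `k` is the generic number of distinct eigenvalues, every
nonzero summand of `Δ_k` contains the squared difference of any two distinct eigenvalues as a
factor, whence `|Δ̃_k| ≤ const * ‖B‖ ^ 2` (`norm_deltaTilde_le`). As `Δ̃_k` is not infinitely flat,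
neither is `B`, so `B = (t - t₀) ^ p • D` with `D` of class `𝒞`, normal, trace-free and nonzero at
`t₀` (`FunctionClass.MemAt.eventually_zero_or_exists_pow_smul`). Hence `D t₀` has a spectral
projection that properly divides the range of `Q t₀` (`exists_polynomial_splitting`). It extends to
a curve of projections of class `𝒞` (`exists_projection_curve`): it is the value at `t₀` of some
polynomial in `D`, whose self-adjoint part is close to a projection, and is turned into a projection
by means of an inverse square root; this root is provided by the inverse function property of `𝒞`.
There are at most `n` summands, so after finitely many steps `A` is scalar on all of them
(`exists_scalar_splitting`).

*Distinctness.* All projections produced in this way commute, for `t ≠ t₀`, with everything that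
commutes with `A t` and its adjoint. This forces the scalars on different summands to be different
for `t ≠ t₀` (`exists_isEigenSystemAt`).

*Gluing.* Two local solutions near `t₀` differ by a relabeling (`IsEigenSystemAt.exists_equiv`), so
that a solution given near one point continues uniquely along the line (`exists_global_of_local`).
The ranks of the projections are constant, and they are the multiplicities of the eigenvalues
(`IsEigenDecomposition.charpoly_eq`).
-/

/-! ### Calculus of vector-valued maps of class `𝒞` -/

namespace FunctionClass

variable (C : FunctionClass)

open TopologicalSpace (Opens)

theorem sec_mono {q : ℕ} {U V : Opens (Fin q → ℝ)} (h : V ≤ U) {f : (Fin q → ℝ) → ℝ}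
    (hf : f ∈ C.sec U) : f ∈ C.sec V := by
  refine C.comp V U id (fun x hx => h hx) (fun i => ?_) f hf
  simpa using C.polynomial V (MvPolynomial.X i)

theorem coord_mem_sec {q : ℕ} (U : Opens (Fin q → ℝ)) (i : Fin q) :
    (fun x => x i) ∈ C.sec U := by
  simpa using C.polynomial U (MvPolynomial.X i)

theorem const_mem_sec {q : ℕ} (U : Opens (Fin q → ℝ)) (c : ℝ) : (fun _ => c) ∈ C.sec U := by
  simpa using C.polynomial U (MvPolynomial.C c)

/-- A map from an open subset `U` of `ℝ^q` to a real vector space `E` is of class `𝒞` if its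
composition with every linear functional on `E` belongs to `𝒞(U)`. -/
def MemOn {q : ℕ} {E : Type*} [AddCommGroup E] [Module ℝ E] (U : Opens (Fin q → ℝ))
    (F : (Fin q → ℝ) → E) : Prop :=
  ∀ ℓ : E →ₗ[ℝ] ℝ, (fun x => ℓ (F x)) ∈ C.sec U

/-- The germ at `t₀` of the curve `F : ℝ → E` is of class `𝒞`. The parameter line `ℝ` is identified
with `Fin 1 → ℝ`. -/
def MemAt {E : Type*} [AddCommGroup E] [Module ℝ E] (F : ℝ → E) (t₀ : ℝ) : Prop :=
  ∃ W : Opens (Fin 1 → ℝ), (fun _ => t₀) ∈ W ∧ C.MemOn W fun x => F (x 0)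

variable {C}

section Module

variable {q : ℕ} {U V : Opens (Fin q → ℝ)}
variable {E E' E'' : Type*} [AddCommGroup E] [Module ℝ E] [AddCommGroup E'] [Module ℝ E']
  [AddCommGroup E''] [Module ℝ E'']

theorem MemOn.mono (h : V ≤ U) {F : (Fin q → ℝ) → E} (hF : C.MemOn U F) : C.MemOn V F :=
  fun ℓ => C.sec_mono h (hF ℓ)

theorem MemOn.congr {F G : (Fin q → ℝ) → E} (hF : C.MemOn U F) (h : Set.EqOn F G U) :
    C.MemOn U G :=
  fun ℓ => C.congr U _ _ (hF ℓ) fun x hx => by simp [h hx]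

theorem memOn_const (c : E) : C.MemOn U fun _ => c := fun _ => C.const_mem_sec U _

theorem MemOn.linear {F : (Fin q → ℝ) → E} (hF : C.MemOn U F) (L : E →ₗ[ℝ] E') :
    C.MemOn U fun x => L (F x) :=
  fun ℓ => hF (ℓ ∘ₗ L)

theorem MemOn.add {F G : (Fin q → ℝ) → E} (hF : C.MemOn U F) (hG : C.MemOn U G) :
    C.MemOn U fun x => F x + G x := fun ℓ => by
  simpa using! add_mem (hF ℓ) (hG ℓ)

theorem MemOn.sum {ι : Type*} (s : Finset ι) {F : ι → (Fin q → ℝ) → E}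
    (hF : ∀ i ∈ s, C.MemOn U (F i)) : C.MemOn U fun x => ∑ i ∈ s, F i x := fun ℓ => by
  have := sum_mem (S := C.sec U) (t := s) (f := fun i x => ℓ (F i x)) fun i hi => hF i hi ℓ
  convert this using 1
  ext x
  simp

theorem memOn_of_mem_sec {f : (Fin q → ℝ) → ℝ} (hf : f ∈ C.sec U) : C.MemOn U f := fun ℓ => by
  have : (fun x => ℓ (f x)) = (ℓ 1) • f := by
    ext x
    have := ℓ.map_smul (f x) 1
    simp only [smul_eq_mul, mul_one] at this
    simp [this, mul_comm]
  rw [this]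
  exact Subalgebra.smul_mem _ hf _

theorem MemOn.smul_const {f : (Fin q → ℝ) → ℝ} (hf : f ∈ C.sec U) (v : E) :
    C.MemOn U fun x => f x • v :=
  (memOn_of_mem_sec hf).linear (LinearMap.toSpanSingleton ℝ E v)

theorem memOn_of_basis {ι : Type*} [Fintype ι] (b : Module.Basis ι ℝ E) {F : (Fin q → ℝ) → E}
    (hF : ∀ i, (fun x => b.repr (F x) i) ∈ C.sec U) : C.MemOn U F := by
  have := MemOn.sum (C := C) (U := U) Finset.univ fun i _ => MemOn.smul_const (hF i) (b i)
  simpa [b.sum_repr] using this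

theorem MemOn.smul {f : (Fin q → ℝ) → ℝ} {F : (Fin q → ℝ) → E} (hf : f ∈ C.sec U)
    (hF : C.MemOn U F) : C.MemOn U fun x => f x • F x := fun ℓ => by
  simpa using! mul_mem hf (hF ℓ)

theorem MemOn.bilinear [FiniteDimensional ℝ E] {F : (Fin q → ℝ) → E} {G : (Fin q → ℝ) → E'}
    (hF : C.MemOn U F) (hG : C.MemOn U G) (B : E →ₗ[ℝ] E' →ₗ[ℝ] E'') :
    C.MemOn U fun x => B (F x) (G x) := by
  have b := Module.finBasis ℝ E
  have h : ∀ x, B (F x) (G x) = ∑ i, b.repr (F x) i • B (b i) (G x) := by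
    intro x
    conv_lhs => rw [← b.sum_repr (F x)]
    simp only [map_sum, map_smul, LinearMap.sum_apply, LinearMap.smul_apply]
  simp only [h]
  exact MemOn.sum _ fun i _ => MemOn.smul (hF (b.coord i)) (hG.linear (B (b i)))

theorem MemOn.prodMk {F : (Fin q → ℝ) → E} {G : (Fin q → ℝ) → E'}
    (hF : C.MemOn U F) (hG : C.MemOn U G) : C.MemOn U fun x => (F x, G x) := by
  simpa using (hF.linear (LinearMap.inl ℝ E E')).add (hG.linear (LinearMap.inr ℝ E E'))

theorem MemOn.comp {p : ℕ} {W : Opens (Fin p → ℝ)} {F : (Fin p → ℝ) → E}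
    {φ : (Fin q → ℝ) → (Fin p → ℝ)} (hF : C.MemOn W F) (hφ : C.MemOn U φ) (h : Set.MapsTo φ U W) :
    C.MemOn U fun x => F (φ x) :=
  fun ℓ => C.comp U W φ h (fun i => hφ (LinearMap.proj i)) _ (hF ℓ)

theorem memOn_id : C.MemOn U fun x => x :=
  memOn_of_basis (Pi.basisFun ℝ (Fin q)) fun i => by simpa using C.coord_mem_sec U i

variable {F : ℝ → E} {t₀ : ℝ}

/-- Neighborhoods of `t₀` in `ℝ` come from open subsets of `Fin 1 → ℝ`. -/
theorem exists_opens_of_eventually {p : ℝ → Prop} (h : ∀ᶠ t in 𝓝 t₀, p t) :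
    ∃ W : Opens (Fin 1 → ℝ), (fun _ => t₀) ∈ W ∧ ∀ x ∈ W, p (x 0) := by
  obtain ⟨u, hu, ho, hm⟩ := eventually_nhds_iff.mp h
  exact ⟨⟨(fun x : Fin 1 → ℝ => x 0) ⁻¹' u, ho.preimage (continuous_apply 0)⟩, hm,
    fun x hx => hu _ hx⟩

theorem eventually_of_opens {W : Opens (Fin 1 → ℝ)} (hW : (fun _ => t₀) ∈ W) :
    ∀ᶠ t in 𝓝 t₀, (fun _ : Fin 1 => t) ∈ W := by
  have hc : Continuous fun (t : ℝ) (_ : Fin 1) => t := by fun_prop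
  exact hc.continuousAt.eventually (W.isOpen.mem_nhds hW)

theorem fin_one_eq (x : Fin 1 → ℝ) : (fun _ => x 0) = x := by
  ext i
  rw [Subsingleton.elim i 0]

theorem MemAt.congr {G : ℝ → E} (hF : C.MemAt F t₀) (h : F =ᶠ[𝓝 t₀] G) : C.MemAt G t₀ := by
  obtain ⟨W, hW, hFW⟩ := hF
  obtain ⟨W', hW', h'⟩ := exists_opens_of_eventually h
  exact ⟨W ⊓ W', ⟨hW, hW'⟩, (hFW.mono inf_le_left).congr fun x hx => h' x hx.2⟩

theorem MemAt.eventually (hF : C.MemAt F t₀) : ∀ᶠ t in 𝓝 t₀, C.MemAt F t := by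
  obtain ⟨W, hW, hFW⟩ := hF
  exact (eventually_of_opens hW).mono fun t ht => ⟨W, ht, hFW⟩

theorem memAt_const (c : E) : C.MemAt (fun _ => c) t₀ := ⟨⊤, trivial, memOn_const c⟩

theorem MemAt.linear (hF : C.MemAt F t₀) (L : E →ₗ[ℝ] E') : C.MemAt (fun t => L (F t)) t₀ := by
  obtain ⟨W, hW, hFW⟩ := hF
  exact ⟨W, hW, hFW.linear L⟩

theorem MemAt.prodMk {G : ℝ → E'} (hF : C.MemAt F t₀) (hG : C.MemAt G t₀) :
    C.MemAt (fun t => (F t, G t)) t₀ := by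
  obtain ⟨W, hW, hFW⟩ := hF
  obtain ⟨W', hW', hGW⟩ := hG
  exact ⟨W ⊓ W', ⟨hW, hW'⟩, (hFW.mono inf_le_left).prodMk (hGW.mono inf_le_right)⟩

theorem MemAt.add {G : ℝ → E} (hF : C.MemAt F t₀) (hG : C.MemAt G t₀) :
    C.MemAt (fun t => F t + G t) t₀ :=
  (hF.prodMk hG).linear (LinearMap.coprod LinearMap.id LinearMap.id)

theorem MemAt.sub {G : ℝ → E} (hF : C.MemAt F t₀) (hG : C.MemAt G t₀) :
    C.MemAt (fun t => F t - G t) t₀ := by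
  simpa [sub_eq_add_neg] using hF.add (hG.linear (-LinearMap.id))

theorem MemAt.const_smul (hF : C.MemAt F t₀) (c : ℝ) : C.MemAt (fun t => c • F t) t₀ :=
  hF.linear (c • LinearMap.id)

theorem memAt_sum {ι : Type*} (s : Finset ι) {F : ι → ℝ → E}
    (hF : ∀ i ∈ s, C.MemAt (F i) t₀) : C.MemAt (fun t => ∑ i ∈ s, F i t) t₀ := by
  classical
  induction s using Finset.induction_on with
  | empty => simpa using memAt_const (0 : E)
  | insert a s ha ih =>
    simp only [Finset.sum_insert ha]
    exact (hF a (Finset.mem_insert_self a s)).add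
      (ih fun i hi => hF i (Finset.mem_insert_of_mem hi))

theorem MemAt.bilinear [FiniteDimensional ℝ E] {G : ℝ → E'} (hF : C.MemAt F t₀)
    (hG : C.MemAt G t₀) (B : E →ₗ[ℝ] E' →ₗ[ℝ] E'') : C.MemAt (fun t => B (F t) (G t)) t₀ := by
  obtain ⟨W, hW, hFW⟩ := hF
  obtain ⟨W', hW', hGW⟩ := hG
  exact ⟨W ⊓ W', ⟨hW, hW'⟩, (hFW.mono inf_le_left).bilinear (hGW.mono inf_le_right) B⟩

end Module

section Algebra

variable {E : Type*} [Ring E] [Algebra ℝ E] [FiniteDimensional ℝ E] {F G : ℝ → E} {t₀ : ℝ}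

theorem MemAt.mul (hF : C.MemAt F t₀) (hG : C.MemAt G t₀) : C.MemAt (fun t => F t * G t) t₀ :=
  hF.bilinear hG (LinearMap.mul ℝ E)

theorem MemAt.pow (hF : C.MemAt F t₀) (n : ℕ) : C.MemAt (fun t => F t ^ n) t₀ := by
  induction n with
  | zero => simpa using memAt_const (1 : E)
  | succ n ih =>
    simp only [pow_succ]
    exact ih.mul hF

end Algebra

section Smooth

variable {E : Type*} [NormedAddCommGroup E] [NormedSpace ℝ E] [FiniteDimensional ℝ E]
  {F : ℝ → E} {t₀ : ℝ}

theorem MemOn.contDiffOn {q : ℕ} {U : Opens (Fin q → ℝ)} {F : (Fin q → ℝ) → E}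
    (hF : C.MemOn U F) : ContDiffOn ℝ ∞ F U := by
  have b := Module.finBasis ℝ E
  have h : F = fun x => ∑ i, b.repr (F x) i • b i := by
    ext x
    rw [b.sum_repr]
  rw [h]
  exact ContDiffOn.sum fun i _ => (C.smooth U _ (hF (b.coord i))).smul contDiffOn_const

theorem MemAt.contDiffAt (hF : C.MemAt F t₀) : ContDiffAt ℝ ∞ F t₀ := by
  obtain ⟨W, hW, hFW⟩ := hF
  have h1 : ContDiffAt ℝ ∞ (fun x : Fin 1 → ℝ => F (x 0)) (fun _ => t₀) :=
    hFW.contDiffOn.contDiffAt (W.isOpen.mem_nhds hW)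
  have h2 : ContDiffAt ℝ ∞ (fun (t : ℝ) (_ : Fin 1) => t) t₀ :=
    contDiffAt_pi.mpr fun _ => contDiffAt_id
  exact ContDiffAt.comp (g := fun x : Fin 1 → ℝ => F (x 0)) t₀ h1 h2

theorem MemAt.continuousAt (hF : C.MemAt F t₀) : ContinuousAt F t₀ := hF.contDiffAt.continuousAt

/-- Division of a curve vanishing at `t₀` by `t - t₀`. -/
theorem MemAt.exists_eq_smul (hF : C.MemAt F t₀) (h0 : F t₀ = 0) :
    ∃ G : ℝ → E, C.MemAt G t₀ ∧ ∀ᶠ t in 𝓝 t₀, F t = (t - t₀) • G t := by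
  obtain ⟨W, hW, hFW⟩ := hF
  have b := Module.finBasis ℝ E
  have key : ∀ i, ∃ h ∈ C.sec W, ∀ x ∈ W, b.repr (F (x 0)) i = (x 0 - t₀) * h x := fun i =>
    C.division W 0 t₀ _ (hFW (b.coord i)) fun x _ hx => by simp [hx, h0]
  choose h hh hx using key
  refine ⟨fun t => ∑ i, h i (fun _ => t) • b i, ⟨W, hW, ?_⟩, ?_⟩
  · simp only [fin_one_eq]
    exact MemOn.sum _ fun i _ => MemOn.smul_const (hh i) (b i)
  · filter_upwards [eventually_of_opens hW] with t ht
    rw [← b.sum_repr (F t), Finset.smul_sum]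
    refine Finset.sum_congr rfl fun i _ => ?_
    rw [smul_smul, ← hx i _ ht]

/-- Either the germ is divisible by all powers of `t - t₀`, or a highest power can be split off. -/
theorem MemAt.exists_pow_smul (hF : C.MemAt F t₀) :
    (∀ p : ℕ, ∃ G : ℝ → E, C.MemAt G t₀ ∧ ∀ᶠ t in 𝓝 t₀, F t = (t - t₀) ^ p • G t) ∨
    ∃ (p : ℕ) (G : ℝ → E), C.MemAt G t₀ ∧ G t₀ ≠ 0 ∧ ∀ᶠ t in 𝓝 t₀, F t = (t - t₀) ^ p • G t := by
  by_cases hne : ∃ (p : ℕ) (G : ℝ → E), C.MemAt G t₀ ∧ G t₀ ≠ 0 ∧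
      ∀ᶠ t in 𝓝 t₀, F t = (t - t₀) ^ p • G t
  · exact Or.inr hne
  refine Or.inl fun p => ?_
  induction p with
  | zero => exact ⟨F, hF, by simp⟩
  | succ p ih =>
    obtain ⟨G, hG, hFG⟩ := ih
    have hG0 : G t₀ = 0 := by
      by_contra h
      exact hne ⟨p, G, hG, h, hFG⟩
    obtain ⟨G', hG', hGG'⟩ := hG.exists_eq_smul hG0
    refine ⟨G', hG', ?_⟩
    filter_upwards [hFG, hGG'] with t h1 h2
    rw [h1, h2, smul_smul, pow_succ]

end Smooth

end FunctionClass

/-! ### Flatness -/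

theorem iteratedDeriv_eq_zero_of_eventuallyEq_pow_smul {E : Type*} [NormedAddCommGroup E]
    [NormedSpace ℝ E] (m : ℕ) {f G : ℝ → E} {t₀ : ℝ} (hG : ContDiffAt ℝ ∞ G t₀)
    (h : ∀ᶠ t in 𝓝 t₀, f t = (t - t₀) ^ (m + 1) • G t) : iteratedDeriv m f t₀ = 0 := by
  induction m generalizing f G with
  | zero => simp [h.self_of_nhds]
  | succ m ih =>
    rw [iteratedDeriv_succ']
    have hG' : ContDiffAt ℝ ∞ (deriv G) t₀ := by
      have h1 : ContDiffAt ℝ ∞ (fderiv ℝ G) t₀ := hG.fderiv_right (by simp)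
      exact h1.clm_apply contDiffAt_const
    refine ih (G := fun t => ((m : ℝ) + 2) • G t + (t - t₀) • deriv G t) ?_ ?_
    · exact (contDiffAt_const.smul hG).add ((contDiffAt_id.sub contDiffAt_const).smul hG')
    · have hd : ∀ᶠ t in 𝓝 t₀, DifferentiableAt ℝ G t := by
        have h1 : ContDiffAt ℝ 1 G t₀ := hG.of_le (by simp)
        filter_upwards [h1.eventually (by simp)] with t ht
        exact ht.differentiableAt (by simp)
      filter_upwards [h.eventually_nhds, hd] with t h1 h2
      have h3 : f =ᶠ[𝓝 t] fun t => (t - t₀) ^ (m + 1 + 1) • G t := h1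
      rw [h3.deriv_eq]
      have h4 : HasDerivAt (fun t : ℝ => (t - t₀) ^ (m + 1 + 1))
          (((m + 1 + 1 : ℕ) : ℝ) * (t - t₀) ^ (m + 1) * 1) t :=
        ((hasDerivAt_id t).sub_const t₀).pow (m + 1 + 1)
      have h5 := (h4.smul h2.hasDerivAt).deriv
      change deriv (fun t => (t - t₀) ^ (m + 1 + 1) • G t) t = _ at h5
      rw [h5, smul_add, smul_smul, smul_smul, add_comm]
      congr 2
      push_cast
      ring

namespace FunctionClass

variable {C : FunctionClass} {t₀ : ℝ}

/-- A curve with some nonvanishing derivative at `t₀` is bounded below by a power of `|t - t₀|`. -/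
theorem MemAt.exists_lower_bound {E : Type*} [NormedAddCommGroup E] [NormedSpace ℝ E]
    [FiniteDimensional ℝ E] {f : ℝ → E} (hf : C.MemAt f t₀) {m : ℕ}
    (hm : iteratedDeriv m f t₀ ≠ 0) :
    ∃ (c : ℝ) (p : ℕ), 0 < c ∧ ∀ᶠ t in 𝓝 t₀, c * |t - t₀| ^ p ≤ ‖f t‖ := by
  rcases hf.exists_pow_smul with h | ⟨p, G, hG, hG0, h⟩
  · obtain ⟨G, hG, h⟩ := h (m + 1)
    exact absurd (iteratedDeriv_eq_zero_of_eventuallyEq_pow_smul m hG.contDiffAt h) hm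
  · have hpos : 0 < ‖G t₀‖ := norm_pos_iff.mpr hG0
    refine ⟨‖G t₀‖ / 2, p, half_pos hpos, ?_⟩
    have := hG.continuousAt.norm.eventually (lt_mem_nhds (half_lt_self hpos))
    filter_upwards [h, this] with t h1 h2
    rw [h1, norm_smul, norm_pow, Real.norm_eq_abs, mul_comm]
    gcongr

/-- If a nonflat quantity `f` is controlled by `‖g‖ ^ 2` wherever `g` does not vanish, then `g` is
either the zero germ or nonflat. -/
theorem MemAt.eventually_zero_or_exists_pow_smul {E : Type*} [NormedAddCommGroup E]
    [NormedSpace ℝ E] [FiniteDimensional ℝ E] {g : ℝ → E} (hg : C.MemAt g t₀) {f : ℝ → ℝ}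
    {c K : ℝ} {p : ℕ} (hc : 0 < c) (hf : ∀ᶠ t in 𝓝 t₀, c * |t - t₀| ^ p ≤ f t)
    (hfg : ∀ᶠ t in 𝓝 t₀, g t ≠ 0 → f t ≤ K * ‖g t‖ ^ 2) :
    (∀ᶠ t in 𝓝 t₀, g t = 0) ∨ ∃ (p : ℕ) (G : ℝ → E), C.MemAt G t₀ ∧ G t₀ ≠ 0 ∧
      ∀ᶠ t in 𝓝 t₀, g t = (t - t₀) ^ p • G t := by
  rcases hg.exists_pow_smul with h | h
  swap
  · exact Or.inr h
  left
  obtain ⟨G, hG, h⟩ := h (p + 1)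
  have hcont : ContinuousAt (fun t => K * (|t - t₀| ^ (p + 2) * ‖G t‖ ^ 2)) t₀ := by
    have := hG.continuousAt
    fun_prop
  have hlt : ∀ᶠ t in 𝓝 t₀, K * (|t - t₀| ^ (p + 2) * ‖G t‖ ^ 2) < c :=
    hcont.eventually (gt_mem_nhds (by simpa using hc))
  filter_upwards [h, hf, hfg, hlt] with t h1 h2 h3 h4
  by_contra hne
  have ht : t ≠ t₀ := by
    rintro rfl
    simp [h1] at hne
  have hpos : 0 < |t - t₀| ^ p := pow_pos (abs_pos.mpr (sub_ne_zero.mpr ht)) p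
  have h5 := h2.trans (h3 hne)
  rw [h1, norm_smul, norm_pow, Real.norm_eq_abs] at h5
  have h6 : K * (|t - t₀| ^ (p + 1) * ‖G t‖) ^ 2
      = K * (|t - t₀| ^ (p + 2) * ‖G t‖ ^ 2) * |t - t₀| ^ p := by ring
  rw [h6] at h5
  exact absurd (le_of_mul_le_mul_right h5 hpos) (not_le.mpr h4)

/-! ### Local inverses and inverse square roots -/

/-- The inverse function theorem of class `𝒞` on a finite-dimensional space `E` with coordinates
`e`, applied to a curve in the target. -/
theorem MemAt.exists_lift {E : Type*} [NormedAddCommGroup E] [NormedSpace ℝ E] {q : ℕ}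
    (e : (Fin q → ℝ) ≃L[ℝ] E) {Φ : E → E} (hΦ : C.MemOn ⊤ fun x => Φ (e x)) {Φ' : E →L[ℝ] E}
    {a : E} (hΦ' : HasFDerivAt Φ Φ' a) (hinj : Function.Injective Φ') {Y : ℝ → E}
    (hY : C.MemAt Y t₀) (hYa : Y t₀ = Φ a) :
    ∃ X : ℝ → E, C.MemAt X t₀ ∧ X t₀ = a ∧ ∀ᶠ t in 𝓝 t₀, Φ (X t) = Y t := by
  let φ : (Fin q → ℝ) → (Fin q → ℝ) := fun x => e.symm (Φ (e x))
  have hφ : C.MemOn ⊤ φ := hΦ.linear e.symm.toLinearEquiv.toLinearMap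
  let φ' : (Fin q → ℝ) →L[ℝ] (Fin q → ℝ) := (e.symm : E →L[ℝ] _) ∘L Φ' ∘L (e : _ →L[ℝ] E)
  have hφ' : HasFDerivAt φ φ' (e.symm a) := by
    have h1 : HasFDerivAt Φ Φ' (e (e.symm a)) := by simpa using hΦ'
    exact e.symm.hasFDerivAt.comp _ (h1.comp _ e.hasFDerivAt)
  have hdet : IsUnit (Matrix.of fun i j : Fin q =>
      fderiv ℝ (fun x => φ x i) (e.symm a) (Pi.single j 1)).det := by
    have hM : (Matrix.of fun i j : Fin q =>
        fderiv ℝ (fun x => φ x i) (e.symm a) (Pi.single j 1)) =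
        LinearMap.toMatrix' (φ' : (Fin q → ℝ) →ₗ[ℝ] (Fin q → ℝ)) := by
      ext i j
      have := ((hasFDerivAt_pi'.mp hφ') i).fderiv
      rw [Matrix.of_apply, this, LinearMap.toMatrix'_apply]
      rfl
    rw [hM, LinearMap.det_toMatrix', ← LinearMap.isUnit_iff_isUnit_det,
      LinearMap.isUnit_iff_ker_eq_bot, LinearMap.ker_eq_bot]
    exact e.symm.injective.comp (hinj.comp e.injective)
  obtain ⟨U', V', ψ, -, -, hV', -, -, hψ, hψa, hψφ⟩ := C.inverse ⊤ ⊤ φ (fun _ _ => trivial)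
    (fun i => hφ (LinearMap.proj i)) (e.symm a) trivial hdet
  obtain ⟨W, hW, hYW⟩ := hY
  have hYe : C.MemOn W fun x => e.symm (Y (x 0)) := hYW.linear e.symm.toLinearEquiv.toLinearMap
  have hφa : e.symm (Y t₀) = φ (e.symm a) := by simp [φ, hYa]
  have hcont : ContinuousAt (fun t => e.symm (Y t)) t₀ :=
    (MemAt.continuousAt (C := C) ⟨W, hW, hYe⟩)
  have hev : ∀ᶠ t in 𝓝 t₀, e.symm (Y t) ∈ V' :=
    hcont.eventually (V'.isOpen.mem_nhds (by simpa only [hφa, SetLike.mem_coe] using hV'))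
  obtain ⟨W', hW', hev'⟩ := exists_opens_of_eventually hev
  have hψ' : C.MemOn V' ψ := memOn_of_basis (Pi.basisFun ℝ (Fin q)) fun i => by simpa using hψ i
  refine ⟨fun t => e (ψ (e.symm (Y t))), ⟨W ⊓ W', ⟨hW, hW'⟩, ?_⟩, ?_, ?_⟩
  · exact (hψ'.comp (hYe.mono inf_le_left) fun x hx => hev' x hx.2).linear
      e.toLinearEquiv.toLinearMap
  · simp [hφa, hψa]
  · filter_upwards [hev] with t ht
    have := hψφ _ ht
    exact e.symm.injective this

/-- Inverse square roots near `1`, obtained by solving `(x, x * (y * y)) = (W t, 1)`. -/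
theorem MemAt.exists_inv_sqrt {E : Type*} [NormedRing E] [NormedAlgebra ℝ E]
    [FiniteDimensional ℝ E] {W : ℝ → E} (hW : C.MemAt W t₀) (h1 : W t₀ = 1) :
    ∃ R : ℝ → E, C.MemAt R t₀ ∧ R t₀ = 1 ∧ ∀ᶠ t in 𝓝 t₀, W t * (R t * R t) = 1 := by
  let e : (Fin (Module.finrank ℝ (E × E)) → ℝ) ≃L[ℝ] E × E :=
    (Module.finBasis ℝ (E × E)).equivFun.symm.toContinuousLinearEquiv
  let Φ : E × E → E × E := fun x => (x.1, x.1 * (x.2 * x.2))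
  have hΦ : C.MemOn ⊤ fun x => Φ (e x) := by
    have he : C.MemOn ⊤ fun x => e x := memOn_id.linear e.toLinearEquiv.toLinearMap
    have hf := he.linear (LinearMap.fst ℝ E E)
    have hs := he.linear (LinearMap.snd ℝ E E)
    exact hf.prodMk (hf.bilinear (hs.bilinear hs (LinearMap.mul ℝ E)) (LinearMap.mul ℝ E))
  let Φ' : E × E →L[ℝ] E × E := (ContinuousLinearMap.fst ℝ E E).prod
    (((2 : ℝ) • ContinuousLinearMap.snd ℝ E E) + ContinuousLinearMap.fst ℝ E E)
  have hd : HasFDerivAt Φ Φ' (1, 1) := by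
    have hf := hasFDerivAt_fst (𝕜 := ℝ) (p := ((1, 1) : E × E))
    have hs := hasFDerivAt_snd (𝕜 := ℝ) (p := ((1, 1) : E × E))
    have h := hf.prodMk (hf.mul' (hs.mul' hs))
    refine HasFDerivAt.congr_fderiv (f := Φ) h ?_
    ext x <;> simp [Φ', two_smul]
  have hinj : Function.Injective Φ' := by
    refine (injective_iff_map_eq_zero Φ').mpr ?_
    rintro ⟨x, y⟩ h
    simp only [Φ', ContinuousLinearMap.prod_apply, add_apply,
      smul_apply, ContinuousLinearMap.coe_fst', ContinuousLinearMap.coe_snd',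
      Prod.mk_eq_zero] at h
    obtain ⟨rfl, h⟩ := h
    simpa using h
  obtain ⟨X, hX, hX1, hXW⟩ := (hW.prodMk (memAt_const (1 : E))).exists_lift e hΦ hd hinj
    (by simp [Φ, h1])
  refine ⟨fun t => (X t).2, hX.linear (LinearMap.snd ℝ E E), by simp [hX1], ?_⟩
  filter_upwards [hXW] with t ht
  simp only [Φ, Prod.mk.injEq] at ht
  rw [← ht.1, ht.2]

end FunctionClass

/-! ### The discriminants `Δ̃_k` of a split polynomial -/

section RootDelta

open Finset Polynomial

variable {n : ℕ}

theorem deltaTilde_prod_X_sub_C (k : ℕ) (lam : Fin n → ℂ) :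
    deltaTilde n k (∏ i, (X - C (lam i))) = MvPolynomial.eval lam (rootDelta n k) := by
  have hcoeff : ∀ i : Fin n, (-1) ^ ((i : ℕ) + 1) *
      (∏ i, (X - C (lam i))).coeff (n - ((i : ℕ) + 1)) =
      MvPolynomial.aeval lam (MvPolynomial.esymm (Fin n) ℂ (i + 1)) := by
    intro i
    have h := Multiset.prod_X_sub_C_coeff (univ.val.map lam) (k := n - ((i : ℕ) + 1)) (by simp)
    have hi : n - (n - ((i : ℕ) + 1)) = i + 1 := by omega
    rw [Multiset.map_map, Multiset.card_map, card_val, card_univ, Fintype.card_fin, hi] at h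
    have h2 : ((-1 : ℂ) ^ ((i : ℕ) + 1)) * (-1) ^ ((i : ℕ) + 1) = 1 := by
      rw [← mul_pow]
      simp
    have h3 : (∏ i, (X - C (lam i))).coeff (n - ((i : ℕ) + 1)) =
        (-1) ^ ((i : ℕ) + 1) * (univ.val.map lam).esymm (i + 1) := h
    rw [MvPolynomial.aeval_esymm_eq_multiset_esymm, h3, ← mul_assoc, h2, one_mul]
  have hsymm : MvPolynomial.esymmAlgHom (Fin n) ℂ n (rootDeltaTilde n k) =
      ⟨rootDelta n k, rootDelta_isSymmetric n k⟩ := by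
    rw [← MvPolynomial.esymmAlgEquiv_apply _ _ (Fintype.card_fin n), rootDeltaTilde,
      AlgEquiv.apply_symm_apply]
  have hval := congrArg (Subtype.val) hsymm
  rw [MvPolynomial.esymmAlgHom_apply] at hval
  have hval : MvPolynomial.aeval (fun i : Fin n => MvPolynomial.esymm (Fin n) ℂ (i + 1))
      (rootDeltaTilde n k) = rootDelta n k := hval
  rw [deltaTilde]
  simp only [hcoeff]
  rw [← hval, ← MvPolynomial.coe_aeval_eq_eval, ← MvPolynomial.coe_aeval_eq_eval]
  exact (MvPolynomial.comp_aeval_apply (f := fun i : Fin n => MvPolynomial.esymm (Fin n) ℂ (i + 1))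
    (MvPolynomial.aeval lam) _).symm

theorem eval_rootDelta (k : ℕ) (lam : Fin n → ℂ) : MvPolynomial.eval lam (rootDelta n k) =
    ∑ s ∈ powersetCard k univ, ∏ p ∈ (s ×ˢ s).filter (fun p => p.1 < p.2),
      (lam p.1 - lam p.2) ^ 2 := by
  simp [rootDelta]

theorem exists_charpoly_eq_prod (B : Matrix (Fin n) (Fin n) ℂ) :
    ∃ lam : Fin n → ℂ, B.charpoly = ∏ i, (X - C (lam i)) := by
  have hs := IsAlgClosed.splits B.charpoly
  have hc : B.charpoly.roots.card = n := by
    rw [← hs.natDegree_eq_card_roots, Matrix.charpoly_natDegree_eq_dim, Fintype.card_fin]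
  obtain ⟨l, hl⟩ := Quot.exists_rep B.charpoly.roots
  have hl' : (l : Multiset ℂ) = B.charpoly.roots := hl
  have hn : l.length = n := by
    rw [← hc, ← hl', Multiset.coe_card]
  subst hn
  refine ⟨l.get, ?_⟩
  have h := hs.eq_prod_roots_of_monic B.charpoly_monic
  rw [h, ← hl', Multiset.map_coe, Multiset.prod_coe, ← List.prod_ofFn]
  congr 1
  conv_lhs => rw [← List.ofFn_get l]
  rw [List.map_ofFn]
  rfl

theorem roots_toFinset_prod (lam : Fin n → ℂ) :
    (∏ i, (X - C (lam i))).roots.toFinset = univ.image lam := by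
  ext z
  simp only [Multiset.mem_toFinset, mem_image, mem_univ, true_and]
  rw [mem_roots (Monic.ne_zero (monic_prod_of_monic _ _ fun i _ => monic_X_sub_C _))]
  rw [IsRoot, eval_prod, prod_eq_zero_iff]
  simp [sub_eq_zero, eq_comm]

/-- Up to a sign, the squared Vandermonde product over a finite index set only depends on the image
of the set. -/
theorem prod_sq_sub_eq (lam : Fin n → ℂ) (s : Finset (Fin n)) (h : Set.InjOn lam s) :
    ∏ p ∈ (s ×ˢ s).filter (fun p => p.1 < p.2), (lam p.1 - lam p.2) ^ 2 =
      (-1) ^ (s.offDiag.card / 2) * ∏ p ∈ (s.image lam).offDiag, (p.1 - p.2) := by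
  have himg : ∏ p ∈ (s.image lam).offDiag, (p.1 - p.2) =
      ∏ p ∈ s.offDiag, (lam p.1 - lam p.2) := by
    refine (prod_bij (fun p _ => (lam p.1, lam p.2)) ?_ ?_ ?_ ?_).symm
    · rintro ⟨a, b⟩ hp
      rw [mem_offDiag] at hp ⊢
      exact ⟨mem_image_of_mem _ hp.1, mem_image_of_mem _ hp.2.1, h.ne hp.1 hp.2.1 hp.2.2⟩
    · rintro ⟨a, b⟩ hp ⟨a', b'⟩ hp' heq
      rw [mem_offDiag] at hp hp'
      obtain ⟨h1, h2⟩ := Prod.mk.inj heq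
      exact Prod.ext (h hp.1 hp'.1 h1) (h hp.2.1 hp'.2.1 h2)
    · rintro ⟨x, y⟩ hp
      obtain ⟨hx, hy, hxy⟩ := mem_offDiag.mp hp
      obtain ⟨a, ha, rfl⟩ := mem_image.mp hx
      obtain ⟨b, hb, rfl⟩ := mem_image.mp hy
      exact ⟨(a, b), mem_offDiag.mpr ⟨ha, hb, fun hab => hxy (congrArg lam hab)⟩, rfl⟩
    · simp
  have hlt : (s ×ˢ s).filter (fun p => p.1 < p.2) = s.offDiag.filter fun p => p.1 < p.2 := by
    ext ⟨a, b⟩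
    simp only [mem_filter, mem_product, mem_offDiag]
    exact ⟨fun hp => ⟨⟨hp.1.1, hp.1.2, hp.2.ne⟩, hp.2⟩, fun hp => ⟨⟨hp.1.1, hp.1.2.1⟩, hp.2⟩⟩
  have hgt : s.offDiag.filter (fun p => ¬ p.1 < p.2) =
      (s.offDiag.filter fun p => p.1 < p.2).map (Equiv.prodComm _ _).toEmbedding := by
    ext ⟨a, b⟩
    simp only [mem_filter, mem_offDiag, mem_map_equiv]
    constructor
    · rintro ⟨⟨h1, h2, h3⟩, h4⟩
      exact ⟨⟨h2, h1, Ne.symm h3⟩, lt_of_le_of_ne (not_lt.mp h4) (Ne.symm h3)⟩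
    · rintro ⟨⟨h1, h2, h3⟩, h4⟩
      exact ⟨⟨h2, h1, Ne.symm h3⟩, not_lt.mpr (le_of_lt h4)⟩
  have hcard : s.offDiag.card / 2 = (s.offDiag.filter fun p => p.1 < p.2).card := by
    have h1 := card_filter_add_card_filter_not (s := s.offDiag) (fun p => p.1 < p.2)
    rw [hgt, card_map] at h1
    omega
  rw [himg, ← prod_filter_mul_prod_filter_not s.offDiag (fun p => p.1 < p.2), hgt, prod_map,
    ← prod_mul_distrib, hcard, ← prod_const, ← prod_mul_distrib, hlt]
  refine prod_congr rfl fun p _ => ?_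
  simp only [Equiv.coe_toEmbedding, Equiv.prodComm_apply, Prod.fst_swap, Prod.snd_swap]
  ring

/-- If there are exactly `d` distinct roots, then all nonzero summands of `Δ_d` coincide. -/
theorem deltaTilde_card_roots_ne_zero (B : Matrix (Fin n) (Fin n) ℂ) :
    deltaTilde n B.charpoly.roots.toFinset.card B.charpoly ≠ 0 := by
  obtain ⟨lam, hlam⟩ := exists_charpoly_eq_prod B
  rw [hlam, deltaTilde_prod_X_sub_C, eval_rootDelta, roots_toFinset_prod]
  set T := univ.image lam with hT
  set v : ℂ := (-1) ^ (T.offDiag.card / 2) * ∏ p ∈ T.offDiag, (p.1 - p.2) with hv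
  have hv0 : v ≠ 0 := by
    refine mul_ne_zero (pow_ne_zero _ (by simp)) (prod_ne_zero_iff.mpr ?_)
    rintro ⟨a, b⟩ hp
    exact sub_ne_zero.mpr (mem_offDiag.mp hp).2.2
  have hterm : ∀ s ∈ powersetCard T.card univ,
      ∏ p ∈ (s ×ˢ s).filter (fun p => p.1 < p.2), (lam p.1 - lam p.2) ^ 2 =
        if Set.InjOn lam s then v else 0 := by
    intro s hs
    have hcard := (mem_powersetCard.mp hs).2
    split_ifs with hinj
    · rw [prod_sq_sub_eq lam s hinj]
      have : s.image lam = T := eq_of_subset_of_card_le (image_subset_image (subset_univ s))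
        (by rw [card_image_of_injOn hinj, hcard])
      rw [this, hv, offDiag_card, offDiag_card, hcard]
    · simp only [Set.InjOn, not_forall] at hinj
      obtain ⟨a, ha, b, hb, hab, hne⟩ := hinj
      rcases lt_or_gt_of_ne hne with hlt | hlt
      · exact prod_eq_zero (i := (a, b)) (by simp_all) (by simp [hab])
      · exact prod_eq_zero (i := (b, a)) (by simp_all) (by simp [hab])
  rw [sum_congr rfl hterm, ← sum_filter, sum_const, nsmul_eq_mul]
  refine mul_ne_zero (Nat.cast_ne_zero.mpr ?_) hv0
  obtain ⟨s, -, hinj, himg⟩ := Finset.exists_subset_injOn_image_eq_of_surjOn (f := lam)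
    Set.univ T fun z hz => by simpa [hT] using hz
  refine (card_pos.mpr ⟨s, ?_⟩).ne'
  rw [mem_filter, mem_powersetCard]
  exact ⟨⟨subset_univ s, by rw [← himg, card_image_of_injOn hinj]⟩, hinj⟩

/-- If there are at most `k` distinct roots, then every nonzero summand of `Δ_k` contains the
squared difference of any two given roots as a factor. -/
theorem norm_deltaTilde_le (B : Matrix (Fin n) (Fin n) ℂ) {k : ℕ}
    (hk : B.charpoly.roots.toFinset.card ≤ k) {L : ℝ} (hL : ∀ z ∈ B.charpoly.roots, ‖z‖ ≤ L)
    {z w : ℂ} (hz : z ∈ B.charpoly.roots) (hw : w ∈ B.charpoly.roots) (hzw : z ≠ w) :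
    ‖deltaTilde n k B.charpoly‖ ≤ 2 ^ n * (1 + (2 * L) ^ 2) ^ (n * n) * ‖z - w‖ ^ 2 := by
  rw [← Multiset.mem_toFinset] at hz hw
  have hL : ∀ z ∈ B.charpoly.roots.toFinset, ‖z‖ ≤ L := fun z hz =>
    hL z (Multiset.mem_toFinset.mp hz)
  obtain ⟨lam, hlam⟩ := exists_charpoly_eq_prod B
  rw [hlam, roots_toFinset_prod] at hk hz hw hL
  rw [hlam, deltaTilde_prod_X_sub_C, eval_rootDelta]
  have hlamL : ∀ i, ‖lam i‖ ≤ L := fun i => hL _ (mem_image_of_mem lam (mem_univ i))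
  have hpair : ∀ p : Fin n × Fin n, ‖(lam p.1 - lam p.2) ^ 2‖ ≤ 1 + (2 * L) ^ 2 := by
    intro p
    rw [norm_pow]
    have h1 := norm_sub_le (lam p.1) (lam p.2)
    have h2 := hlamL p.1
    have h3 := hlamL p.2
    have h4 : ‖lam p.1 - lam p.2‖ ≤ 2 * L := by linarith
    have h5 : ‖lam p.1 - lam p.2‖ ^ 2 ≤ (2 * L) ^ 2 := by gcongr
    linarith
  have hM : 1 ≤ 1 + (2 * L) ^ 2 := by nlinarith [sq_nonneg L]
  set M := 1 + (2 * L) ^ 2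
  have hterm : ∀ s ∈ powersetCard k univ,
      ‖∏ p ∈ (s ×ˢ s).filter (fun p => p.1 < p.2), (lam p.1 - lam p.2) ^ 2‖ ≤
        M ^ (n * n) * ‖z - w‖ ^ 2 := by
    intro s hs
    have hcard := (mem_powersetCard.mp hs).2
    by_cases hinj : Set.InjOn lam s
    · have himg : s.image lam = univ.image lam :=
        eq_of_subset_of_card_le (image_subset_image (subset_univ s))
          (by rw [card_image_of_injOn hinj, hcard]; exact hk)
      rw [← himg] at hz hw
      obtain ⟨a, ha, rfl⟩ := mem_image.mp hz
      obtain ⟨b, hb, rfl⟩ := mem_image.mp hw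
      have hab : a ≠ b := fun h => hzw (by rw [h])
      obtain ⟨p, hp, hpn⟩ : ∃ p : Fin n × Fin n,
          p ∈ (s ×ˢ s).filter (fun p : Fin n × Fin n => p.1 < p.2) ∧
            ‖(lam p.1 - lam p.2) ^ 2‖ = ‖lam a - lam b‖ ^ 2 := by
        rcases lt_or_gt_of_ne hab with hlt | hlt
        · exact ⟨(a, b), by simp_all, by simp⟩
        · exact ⟨(b, a), by simp_all, by simp [norm_sub_rev]⟩
      rw [← mul_prod_erase _ _ hp, norm_mul, hpn, mul_comm, norm_prod]
      refine mul_le_mul_of_nonneg_right ?_ (by positivity)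
      refine (prod_le_prod (fun _ _ => norm_nonneg _) fun p _ => hpair p).trans ?_
      rw [prod_const]
      refine pow_le_pow_right₀ hM ((card_le_univ _).trans ?_)
      simp
    · simp only [Set.InjOn, not_forall] at hinj
      obtain ⟨a, ha, b, hb, hab, hne⟩ := hinj
      have h0 : ∏ p ∈ (s ×ˢ s).filter (fun p => p.1 < p.2), (lam p.1 - lam p.2) ^ 2 = 0 := by
        rcases lt_or_gt_of_ne hne with hlt | hlt
        · exact prod_eq_zero (i := (a, b)) (by simp_all) (by simp [hab])
        · exact prod_eq_zero (i := (b, a)) (by simp_all) (by simp [hab])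
      rw [h0, norm_zero]
      positivity
  refine (norm_sum_le_of_le _ hterm).trans ?_
  rw [sum_const, nsmul_eq_mul, mul_assoc]
  refine mul_le_mul_of_nonneg_right ?_ (by positivity)
  have : (powersetCard k (univ : Finset (Fin n))).card ≤ 2 ^ n := by
    rw [card_powersetCard]
    simpa using Nat.choose_le_two_pow n k
  exact_mod_cast this

theorem deltaTilde_zero (B : Matrix (Fin n) (Fin n) ℂ) : deltaTilde n 0 B.charpoly = 1 := by
  obtain ⟨lam, hlam⟩ := exists_charpoly_eq_prod B
  rw [hlam, deltaTilde_prod_X_sub_C, eval_rootDelta]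
  simp

theorem deltaTilde_eq_zero_of_lt {k : ℕ} (hk : n < k) (B : Matrix (Fin n) (Fin n) ℂ) :
    deltaTilde n k B.charpoly = 0 := by
  obtain ⟨lam, hlam⟩ := exists_charpoly_eq_prod B
  rw [hlam, deltaTilde_prod_X_sub_C, eval_rootDelta, powersetCard_eq_empty.mpr (by simpa using hk),
    sum_empty]

end RootDelta

/-! ### Orthogonal projections and normal matrices -/

section Matrix

open Polynomial Matrix

variable {n : ℕ}

theorem IsOrthProj.mul_of_commute {P Q : Matrix (Fin n) (Fin n) ℂ} (hP : IsOrthProj P)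
    (hQ : IsOrthProj Q) (h : P * Q = Q * P) : IsOrthProj (P * Q) := by
  refine ⟨?_, ?_⟩
  · rw [mul_assoc, ← mul_assoc Q P Q, ← h, mul_assoc P Q Q, hQ.1, ← mul_assoc, hP.1]
  · rw [conjTranspose_mul, hP.2, hQ.2, h]

theorem IsOrthProj.sub_of_mul_eq {P Q : Matrix (Fin n) (Fin n) ℂ} (hP : IsOrthProj P)
    (hQ : IsOrthProj Q) (h1 : P * Q = P) (h2 : Q * P = P) : IsOrthProj (Q - P) := by
  refine ⟨?_, by rw [conjTranspose_sub, hP.2, hQ.2]⟩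
  rw [sub_mul, mul_sub, mul_sub, hQ.1, h1, h2, hP.1, sub_self, sub_zero]

open scoped ComplexOrder in
theorem IsOrthProj.trace_ne_zero {Q : Matrix (Fin n) (Fin n) ℂ} (hQ : IsOrthProj Q) (h : Q ≠ 0) :
    Q.trace ≠ 0 := by
  intro ht
  refine h (trace_conjTranspose_mul_self_eq_zero_iff.mp ?_)
  rw [hQ.2, hQ.1, ht]

/-- The trace `m` of an orthogonal projection is a natural number, and rescaling its range by `c`
has determinant `c ^ m`. -/
theorem IsOrthProj.exists_trace_eq {P : Matrix (Fin n) (Fin n) ℂ} (hP : IsOrthProj P) :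
    ∃ m : ℕ, P.trace = m ∧ ∀ c : ℂ, (1 + (c - 1) • P).det = c ^ m := by
  have hH : P.IsHermitian := hP.2
  let U := hH.eigenvectorUnitary
  let φ := Unitary.conjStarAlgAut ℂ (Matrix (Fin n) (Fin n) ℂ) U
  let e : Fin n → ℂ := fun i => (hH.eigenvalues i : ℂ)
  have hφ : P = φ (diagonal e) := hH.spectral_theorem
  have he : ∀ i, e i = 0 ∨ e i = 1 := by
    have h1 : diagonal e * diagonal e = diagonal e := by
      refine EquivLike.injective φ ?_
      rw [map_mul, ← hφ, hP.1]
    intro i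
    have h2 := congrFun (congrFun h1 i) i
    rw [diagonal_mul_diagonal, diagonal_apply_eq, diagonal_apply_eq] at h2
    have h3 : e i * (e i - 1) = 0 := by rw [mul_sub, h2, mul_one, sub_self]
    rcases mul_eq_zero.mp h3 with h | h
    · exact Or.inl h
    · exact Or.inr (sub_eq_zero.mp h)
  refine ⟨(Finset.univ.filter fun i => e i = 1).card, ?_, fun c => ?_⟩
  · rw [hφ, Unitary.conjStarAlgAut_apply, trace_mul_comm, ← mul_assoc, Unitary.coe_star_mul_self,
      one_mul, trace_diagonal, Finset.card_filter]
    push_cast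
    refine Finset.sum_congr rfl fun i _ => ?_
    rcases he i with h | h <;> simp [h]
  · have h1 : 1 + (c - 1) • P = φ (diagonal fun i => 1 + (c - 1) * e i) := by
      have h2 : (diagonal fun i => 1 + (c - 1) * e i) = 1 + (c - 1) • diagonal e := by
        rw [← diagonal_one, ← diagonal_smul, diagonal_add]
        rfl
      rw [h2, map_add, map_smul, map_one, ← hφ]
    rw [h1, Unitary.conjStarAlgAut_apply, det_mul_comm, ← mul_assoc, Unitary.coe_star_mul_self,
      one_mul, det_diagonal, Finset.card_filter, ← Finset.prod_pow_eq_pow_sum]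
    refine Finset.prod_congr rfl fun i _ => ?_
    rcases he i with h | h <;> simp [h]

section CFC

open scoped Matrix.Norms.L2Operator

theorem aeval_eq_cfc {M : Matrix (Fin n) (Fin n) ℂ} (hM : M * Mᴴ = Mᴴ * M) (p : ℂ[X]) :
    aeval M p = cfc p.eval M := by
  have : IsStarNormal M := ⟨hM.symm⟩
  exact (cfc_polynomial p M).symm

/-- Polynomials that agree on the spectrum take the same value at a normal matrix. -/
theorem aeval_eq_of_eqOn_spectrum {M : Matrix (Fin n) (Fin n) ℂ} (hM : M * Mᴴ = Mᴴ * M)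
    {p q : ℂ[X]} (h : ∀ z ∈ M.charpoly.roots, p.eval z = q.eval z) : aeval M p = aeval M q := by
  rw [aeval_eq_cfc hM, aeval_eq_cfc hM]
  refine cfc_congr fun z hz => h z ?_
  rw [mem_roots M.charpoly_monic.ne_zero]
  exact mem_spectrum_iff_isRoot_charpoly.mp hz

theorem conjTranspose_aeval_of_real {M : Matrix (Fin n) (Fin n) ℂ} (hM : M * Mᴴ = Mᴴ * M)
    {p : ℂ[X]} (h : ∀ z ∈ M.charpoly.roots, star (p.eval z) = p.eval z) :
    (aeval M p)ᴴ = aeval M p := by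
  rw [aeval_eq_cfc hM, ← star_eq_conjTranspose, ← cfc_star]
  refine cfc_congr fun z hz => h z ?_
  rw [mem_roots M.charpoly_monic.ne_zero]
  exact mem_spectrum_iff_isRoot_charpoly.mp hz

end CFC

/-- The spectral projections of a normal matrix, as polynomials in this matrix. -/
theorem exists_spectral_polynomials {M : Matrix (Fin n) (Fin n) ℂ} (hM : M * Mᴴ = Mᴴ * M) :
    ∃ f : ℂ → ℂ[X], (∀ z ∈ M.charpoly.roots.toFinset, IsOrthProj (aeval M (f z)) ∧
      M * aeval M (f z) = z • aeval M (f z)) ∧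
      ∑ z ∈ M.charpoly.roots.toFinset, aeval M (f z) = 1 := by
  classical
  let σ := M.charpoly.roots.toFinset
  have hσ : ∀ {z}, z ∈ M.charpoly.roots → z ∈ σ := fun h => Multiset.mem_toFinset.mpr h
  have hf : ∀ z ∈ σ, ∀ w ∈ σ, (Lagrange.basis σ id z).eval w = if w = z then 1 else 0 := by
    intro z hz w hw
    split_ifs with h
    · subst h
      exact Lagrange.eval_basis_self (Set.injOn_id _) hz
    · exact Lagrange.eval_basis_of_ne (v := id) (Ne.symm h) hw
  refine ⟨fun z => Lagrange.basis σ id z, fun z hz => ⟨⟨?_, ?_⟩, ?_⟩, ?_⟩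
  · rw [← map_mul]
    refine aeval_eq_of_eqOn_spectrum hM fun w hw => ?_
    rw [eval_mul, hf z hz w (hσ hw)]
    simp
  · refine conjTranspose_aeval_of_real hM fun w hw => ?_
    rw [hf z hz w (hσ hw)]
    split_ifs <;> simp
  · have h1 : M * aeval M (Lagrange.basis σ id z) = aeval M (X * Lagrange.basis σ id z) := by simp
    have h2 : z • aeval M (Lagrange.basis σ id z) = aeval M (z • Lagrange.basis σ id z) := by simp
    rw [h1, h2]
    refine aeval_eq_of_eqOn_spectrum hM fun w hw => ?_
    rw [eval_mul, eval_smul, hf z hz w (hσ hw)]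
    split_ifs with h <;> simp [h]
  · rw [← map_sum, ← map_one (aeval (R := ℂ) M)]
    refine aeval_eq_of_eqOn_spectrum hM fun w hw => ?_
    rw [eval_finsetSum, eval_one]
    change ∑ z ∈ σ, _ = _
    rw [Finset.sum_congr rfl fun z hz => hf z hz w (hσ hw)]
    simp [hσ hw]

theorem commute_aeval {M X : Matrix (Fin n) (Fin n) ℂ} (h : X * M = M * X) (p : ℂ[X]) :
    X * aeval M p = aeval M p * X := by
  have h1 : Commute X M := h
  induction p using Polynomial.induction_on' with
  | add p q hp hq => rw [map_add, mul_add, add_mul, hp, hq]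
  | monomial k a =>
    rw [aeval_monomial]
    exact (Algebra.commute_algebraMap_right a X).mul_right (h1.pow_right k)

/-- A nonzero trace-free normal matrix living on the range of a projection `Q` has a spectral
projection that splits `Q`. -/
theorem exists_polynomial_splitting {D Q : Matrix (Fin n) (Fin n) ℂ} (hD : D * Dᴴ = Dᴴ * D)
    (hQ : IsOrthProj Q) (hDQ : D * Q = D) (hD0 : D ≠ 0) (htr : D.trace = 0) :
    ∃ f : ℂ[X], IsOrthProj (aeval D f) ∧ aeval D f * Q ≠ 0 ∧ aeval D f * Q ≠ Q := by
  obtain ⟨f, hf, hsum⟩ := exists_spectral_polynomials hD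
  by_contra! hcon
  have hQ0 : Q ≠ 0 := by
    rintro rfl
    exact hD0 (by rw [← hDQ, mul_zero])
  obtain ⟨z, hz, hzQ⟩ : ∃ z ∈ D.charpoly.roots.toFinset, aeval D (f z) * Q ≠ 0 := by
    by_contra! h
    refine hQ0 ?_
    rw [← one_mul Q, ← hsum, Finset.sum_mul, Finset.sum_eq_zero h]
  have h1 := hcon (f z) (hf z hz).1 hzQ
  have h2 : D = z • Q := by
    rw [← hDQ, ← h1, ← mul_assoc, (hf z hz).2, smul_mul_assoc, h1]
  have h3 : z = 0 := by
    rw [h2, trace_smul, smul_eq_mul] at htr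
    exact (mul_eq_zero.mp htr).resolve_right (hQ.trace_ne_zero hQ0)
  exact hD0 (by rw [h2, h3, zero_smul])

section Norm

open scoped Matrix.Norms.Operator

theorem norm_le_of_mul_eq_smul {B E : Matrix (Fin n) (Fin n) ℂ} {z : ℂ} (h : B * E = z • E)
    (hE : E ≠ 0) : ‖z‖ ≤ ‖B‖ := by
  have h1 := norm_mul_le B E
  rw [h, norm_smul] at h1
  exact le_of_mul_le_mul_right h1 (norm_pos_iff.mpr hE)

theorem norm_root_charpoly_le {A : Matrix (Fin n) (Fin n) ℂ} {z : ℂ} (hz : z ∈ A.charpoly.roots) :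
    ‖z‖ ≤ ‖A‖ := by
  rw [mem_roots A.charpoly_monic.ne_zero, ← mem_spectrum_iff_isRoot_charpoly] at hz
  rcases n.eq_zero_or_pos with rfl | hn
  · exact absurd hz (by simp [spectrum.of_subsingleton])
  · have : Nonempty (Fin n) := ⟨⟨0, hn⟩⟩
    exact spectrum.norm_le_norm_of_mem hz

theorem IsOrthProj.one_le_norm {P : Matrix (Fin n) (Fin n) ℂ} (hP : IsOrthProj P) (h : P ≠ 0) :
    1 ≤ ‖P‖ := by
  have h1 := norm_mul_le P P
  rw [hP.1] at h1
  exact le_of_mul_le_mul_right (by simpa using h1) (norm_pos_iff.mpr h)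

/-- If `A` is not scalar on the range of `Q`, then it has two distinct eigenvalues whose distance is
controlled by the trace-free part of `A` on this range. -/
theorem exists_roots_norm_sub_le {A Q : Matrix (Fin n) (Fin n) ℂ} (hA : A * Aᴴ = Aᴴ * A)
    (hQ : IsOrthProj Q) (hAQ : A * Q = Q * A) {l : ℂ} (hl : l * Q.trace = (A * Q).trace)
    (hB : A * Q - l • Q ≠ 0) :
    ∃ z ∈ A.charpoly.roots, ∃ w ∈ A.charpoly.roots, z ≠ w ∧ ‖z - w‖ ≤ 2 * ‖A * Q - l • Q‖ := by
  obtain ⟨f, hf, hsum⟩ := exists_spectral_polynomials hA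
  have hQ0 : Q ≠ 0 := by
    rintro rfl
    simp at hB
  obtain ⟨z, hz, hzQ⟩ : ∃ z ∈ A.charpoly.roots.toFinset, aeval A (f z) * Q ≠ 0 := by
    by_contra! h
    refine hQ0 ?_
    rw [← one_mul Q, ← hsum, Finset.sum_mul, Finset.sum_eq_zero h]
  obtain ⟨w, hw, hwz, hwQ⟩ : ∃ w ∈ A.charpoly.roots.toFinset, w ≠ z ∧ aeval A (f w) * Q ≠ 0 := by
    by_contra! h
    have h1 : aeval A (f z) * Q = Q := by
      conv_rhs => rw [← one_mul Q, ← hsum, Finset.sum_mul]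
      exact (Finset.sum_eq_single_of_mem z hz fun w hw hwz => h w hw hwz).symm
    have h2 : A * Q = z • Q := by
      conv_lhs => rw [← h1, ← mul_assoc, (hf z hz).2, smul_mul_assoc, h1]
    rw [h2, trace_smul, smul_eq_mul] at hl
    rw [mul_right_cancel₀ (hQ.trace_ne_zero hQ0) hl, h2, sub_self] at hB
    exact hB rfl
  have key : ∀ z ∈ A.charpoly.roots.toFinset, aeval A (f z) * Q ≠ 0 →
      ‖z - l‖ ≤ ‖A * Q - l • Q‖ := by
    intro z hz hzQ
    refine norm_le_of_mul_eq_smul ?_ hzQ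
    have hc : Q * aeval A (f z) = aeval A (f z) * Q := commute_aeval hAQ.symm _
    have h3 : Q * (aeval A (f z) * Q) = aeval A (f z) * Q := by
      rw [← mul_assoc, hc, mul_assoc, hQ.1]
    rw [sub_mul, mul_assoc, h3, smul_mul_assoc, h3, ← mul_assoc, (hf z hz).2, smul_mul_assoc,
      sub_smul]
  refine ⟨z, Multiset.mem_toFinset.mp hz, w, Multiset.mem_toFinset.mp hw, hwz.symm, ?_⟩
  have h1 := key z hz hzQ
  have h2 := key w hw hwQ
  have h3 := norm_sub_le (z - l) (w - l)
  rw [sub_sub_sub_cancel_right] at h3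
  linarith

end Norm

end Matrix

/-! ### Curves of complex matrices of class `𝒞` -/

section MatrixCurve

open Polynomial Matrix FunctionClass

open scoped Matrix.Norms.Operator

variable {C : FunctionClass} {n : ℕ} {t₀ : ℝ}

theorem memAt_complex_iff {f : ℝ → ℂ} : C.MemAt f t₀ ↔
    C.MemAt (fun t => (f t).re) t₀ ∧ C.MemAt (fun t => (f t).im) t₀ := by
  refine ⟨fun h => ⟨h.linear Complex.reLm, h.linear Complex.imLm⟩, fun ⟨h1, h2⟩ => ?_⟩
  have := (h1.linear (LinearMap.toSpanSingleton ℝ ℂ 1)).add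
    (h2.linear (LinearMap.toSpanSingleton ℝ ℂ Complex.I))
  refine this.congr (Filter.Eventually.of_forall fun t => ?_)
  simp

theorem memAt_real_iff {f : ℝ → ℝ} : (∀ t₀, C.MemAt f t₀) ↔
    (fun x : Fin 1 → ℝ => f (x 0)) ∈ C.sec ⊤ := by
  constructor
  · intro h
    refine C.locality _ _ fun x _ => ?_
    obtain ⟨W, hW, hf⟩ := h (x 0)
    exact ⟨W, by rwa [fin_one_eq] at hW, le_top, hf LinearMap.id⟩
  · exact fun h t₀ => ⟨⊤, trivial, memOn_of_mem_sec h⟩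

theorem memCurve_iff {f : ℝ → ℂ} : C.MemCurve f ↔ ∀ t₀, C.MemAt f t₀ := by
  simp only [memAt_complex_iff, forall_and, memAt_real_iff (f := fun t => (f t).re),
    memAt_real_iff (f := fun t => (f t).im)]
  rfl

theorem memAt_matrix_iff {A : ℝ → Matrix (Fin n) (Fin n) ℂ} : C.MemAt A t₀ ↔
    ∀ i j, C.MemAt (fun t => A t i j) t₀ := by
  refine ⟨fun h i j => h.linear (Matrix.entryLinearMap ℝ ℂ i j), fun h => ?_⟩
  have := memAt_sum Finset.univ fun i _ => memAt_sum Finset.univ fun j _ =>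
    (h i j).linear (Matrix.singleLinearMap ℝ i j : ℂ →ₗ[ℝ] Matrix (Fin n) (Fin n) ℂ)
  refine this.congr (Filter.Eventually.of_forall fun t => ?_)
  exact (matrix_eq_sum_single (A t)).symm

theorem memMatrixCurve_iff {A : ℝ → Matrix (Fin n) (Fin n) ℂ} :
    C.MemMatrixCurve A ↔ ∀ t₀, C.MemAt A t₀ := by
  simp only [FunctionClass.MemMatrixCurve, memCurve_iff, memAt_matrix_iff]
  exact ⟨fun h t i j => h i j t, fun h i j t => h t i j⟩

theorem FunctionClass.MemAt.conjTranspose {A : ℝ → Matrix (Fin n) (Fin n) ℂ} (hA : C.MemAt A t₀) :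
    C.MemAt (fun t => (A t)ᴴ) t₀ :=
  hA.linear
    { toFun := Matrix.conjTranspose
      map_add' := Matrix.conjTranspose_add
      map_smul' := fun c M => by simp }

theorem FunctionClass.MemAt.complex_smul {f : ℝ → ℂ} {A : ℝ → Matrix (Fin n) (Fin n) ℂ}
    (hf : C.MemAt f t₀) (hA : C.MemAt A t₀) : C.MemAt (fun t => f t • A t) t₀ := by
  refine memAt_matrix_iff.mpr fun i j => ?_
  exact hf.mul (memAt_matrix_iff.mp hA i j)

theorem FunctionClass.MemAt.trace {A : ℝ → Matrix (Fin n) (Fin n) ℂ} (hA : C.MemAt A t₀) :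
    C.MemAt (fun t => (A t).trace) t₀ :=
  hA.linear (Matrix.traceLinearMap (Fin n) ℝ ℂ)

theorem FunctionClass.MemAt.aeval {A : ℝ → Matrix (Fin n) (Fin n) ℂ} (hA : C.MemAt A t₀)
    (f : ℂ[X]) : C.MemAt (fun t => Polynomial.aeval (A t) f) t₀ := by
  simp only [aeval_eq_sum_range]
  exact memAt_sum _ fun i _ => (memAt_const (f.coeff i)).complex_smul (hA.pow i)

theorem memAt_eval {σ : Type*} (p : MvPolynomial σ ℂ) {g : σ → ℝ → ℂ}
    (hg : ∀ s, C.MemAt (g s) t₀) : C.MemAt (fun t => MvPolynomial.eval (fun s => g s t) p) t₀ := by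
  induction p using MvPolynomial.induction_on with
  | C a => simpa using memAt_const a
  | add p q hp hq => simpa using hp.add hq
  | mul_X p s hp => simpa using hp.mul (hg s)

theorem memAt_deltaTilde_charpoly {A : ℝ → Matrix (Fin n) (Fin n) ℂ} (hA : C.MemAt A t₀) (k : ℕ) :
    C.MemAt (fun t => deltaTilde n k (A t).charpoly) t₀ := by
  refine memAt_eval _ fun i => (memAt_const _).mul ?_
  have h : ∀ (t : ℝ) (j : ℕ), (A t).charpoly.coeff j =
      MvPolynomial.eval (fun s : Fin n × Fin n => A t s.1 s.2)
        ((charpoly.univ ℂ (Fin n)).coeff j) := fun t j =>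
    (charpoly.univ_coeff_eval₂Hom (Fin n) (RingHom.id ℂ) (fun s => A t s.1 s.2) j).symm
  simp only [h]
  exact memAt_eval _ fun s => memAt_matrix_iff.mp hA s.1 s.2

/-- Normal nonflatness of the characteristic polynomial, in quantitative form: the distance of any
two distinct eigenvalues dominates a quantity that is not infinitely flat at `t₀`. -/
theorem exists_lower_bound_of_nonflat {A : ℝ → Matrix (Fin n) (Fin n) ℂ} (hA : C.MemAt A t₀)
    (h : IsNormallyNonflatAt n (fun t => (A t).charpoly) t₀) :
    ∃ (φ : ℝ → ℝ) (c K : ℝ) (p : ℕ), 0 < c ∧ 0 ≤ K ∧ (∀ᶠ t in 𝓝 t₀, c * |t - t₀| ^ p ≤ φ t) ∧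
      ∀ᶠ t in 𝓝 t₀, ∀ z ∈ (A t).charpoly.roots, ∀ w ∈ (A t).charpoly.roots, z ≠ w →
        φ t ≤ K * ‖z - w‖ ^ 2 := by
  classical
  let S : Set ℕ := {l : ℕ | ¬ ∀ᶠ t in 𝓝 t₀, deltaTilde n l (A t).charpoly = 0}
  have h0 : (0 : ℕ) ∈ S := by simp [S, deltaTilde_zero]
  have hle : ∀ l ∈ S, l ≤ n := by
    intro l hl
    by_contra hlt
    exact hl (Filter.Eventually.of_forall fun t => deltaTilde_eq_zero_of_lt (not_le.mp hlt) _)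
  have hbdd : BddAbove S := ⟨n, hle⟩
  have hgr : IsGreatest S (sSup S) := ⟨Nat.sSup_mem ⟨0, h0⟩ hbdd, fun l hl => le_csSup hbdd hl⟩
  set k := sSup S
  obtain ⟨m, hm⟩ := h k hgr
  obtain ⟨c, p, hc, hlow⟩ := (memAt_deltaTilde_charpoly hA k).exists_lower_bound hm
  -- Near `t₀` there are at most `k` distinct eigenvalues, as `Δ̃_l` vanishes there for `l > k`.
  have hcard : ∀ᶠ t in 𝓝 t₀, (A t).charpoly.roots.toFinset.card ≤ k := by
    have hz : ∀ᶠ t in 𝓝 t₀, ∀ l ∈ Finset.Ioc k n, deltaTilde n l (A t).charpoly = 0 := by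
      rw [Filter.eventually_all_finset]
      intro l hl
      by_contra hne
      exact absurd (hgr.2 hne) (not_le.mpr (Finset.mem_Ioc.mp hl).1)
    filter_upwards [hz] with t ht
    by_contra hlt
    refine deltaTilde_card_roots_ne_zero (A t) (ht _ (Finset.mem_Ioc.mpr ⟨not_le.mp hlt, ?_⟩))
    refine (Multiset.toFinset_card_le _).trans ((card_roots' _).trans ?_)
    rw [charpoly_natDegree_eq_dim, Fintype.card_fin]
  have hbound : ∀ᶠ t in 𝓝 t₀, ‖A t‖ ≤ ‖A t₀‖ + 1 :=
    (hA.continuousAt.norm.eventually (gt_mem_nhds (lt_add_one _))).mono fun t ht => ht.le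
  refine ⟨_, c, 2 ^ n * (1 + (2 * (‖A t₀‖ + 1)) ^ 2) ^ (n * n), p, hc, by positivity, hlow, ?_⟩
  filter_upwards [hcard, hbound] with t h1 h2 z hz w hw hzw
  exact norm_deltaTilde_le (A t) h1 (fun z hz => (norm_root_charpoly_le hz).trans h2) hz hw hzw

end MatrixCurve

/-! ### Extraction of spectral projections of class `𝒞` -/

section Bicommutant

open Polynomial Matrix

variable {n : ℕ}

/-- `Q` belongs to the bicommutant of `A` and `Aᴴ`. -/
def InBicommutant (A Q : Matrix (Fin n) (Fin n) ℂ) : Prop :=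
  ∀ X, X * A = A * X → X * Aᴴ = Aᴴ * X → X * Q = Q * X

variable {A P Q : Matrix (Fin n) (Fin n) ℂ}

theorem inBicommutant_self : InBicommutant A A := fun _ h _ => h

theorem inBicommutant_one : InBicommutant A 1 := fun X _ _ => by simp

theorem InBicommutant.mul (hP : InBicommutant A P) (hQ : InBicommutant A Q) :
    InBicommutant A (P * Q) := fun X h h' =>
  (show Commute X P from hP X h h').mul_right (show Commute X Q from hQ X h h')

theorem InBicommutant.add (hP : InBicommutant A P) (hQ : InBicommutant A Q) :
    InBicommutant A (P + Q) := fun X h h' =>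
  (show Commute X P from hP X h h').add_right (show Commute X Q from hQ X h h')

theorem InBicommutant.sub (hP : InBicommutant A P) (hQ : InBicommutant A Q) :
    InBicommutant A (P - Q) := fun X h h' =>
  (show Commute X P from hP X h h').sub_right (show Commute X Q from hQ X h h')

theorem InBicommutant.smul (hP : InBicommutant A P) (c : ℂ) : InBicommutant A (c • P) :=
  fun X h h' => (show Commute X P from hP X h h').smul_right c

theorem InBicommutant.real_smul (hP : InBicommutant A P) (c : ℝ) : InBicommutant A (c • P) :=
  fun X h h' => (show Commute X P from hP X h h').smul_right c

theorem InBicommutant.aeval (hP : InBicommutant A P) (f : ℂ[X]) :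
    InBicommutant A (Polynomial.aeval P f) := fun X h h' => commute_aeval (hP X h h') f

theorem InBicommutant.conjTranspose (hP : InBicommutant A P) : InBicommutant A Pᴴ := by
  intro X h h'
  have h1 : Xᴴ * P = P * Xᴴ := by
    refine hP _ ?_ ?_
    · simpa using (congrArg Matrix.conjTranspose h').symm
    · simpa using (congrArg Matrix.conjTranspose h).symm
  simpa using (congrArg Matrix.conjTranspose h1).symm

theorem InBicommutant.trans (hP : InBicommutant A P) (hQ : InBicommutant P Q) :
    InBicommutant A Q := fun X h h' => hQ X (hP X h h') (hP.conjTranspose X h h')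

/-- The bicommutant of a normal matrix and its adjoint is commutative. -/
theorem InBicommutant.commute (hA : A * Aᴴ = Aᴴ * A) (hP : InBicommutant A P)
    (hQ : InBicommutant A Q) : P * Q = Q * P :=
  hQ P (hP A rfl hA).symm (hP Aᴴ hA.symm rfl).symm

section Norm

variable {C : FunctionClass} {t₀ : ℝ}

/-- The Sylvester operator `E ↦ S * E + E * T` is injective for `S` and `T` near `1`. -/
theorem eq_zero_of_mul_add_mul_eq_zero {E : Type*} [NormedRing E] [NormedAlgebra ℝ E] {S T x : E}
    (hS : ‖S - 1‖ < 1) (hT : ‖T - 1‖ < 1) (h : S * x + x * T = 0) : x = 0 := by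
  by_contra hx
  have hpos : 0 < ‖x‖ := norm_pos_iff.mpr hx
  have h1 : (2 : ℝ) • x = -((S - 1) * x + x * (T - 1)) := by
    rw [sub_mul, mul_sub, one_mul, mul_one, two_smul]
    have : S * x - x + (x * T - x) = (S * x + x * T) - (x + x) := by abel
    rw [this, h, zero_sub, neg_neg]
  have h2 : ‖(2 : ℝ) • x‖ ≤ ‖S - 1‖ * ‖x‖ + ‖x‖ * ‖T - 1‖ := by
    rw [h1, norm_neg]
    exact (norm_add_le _ _).trans (add_le_add (norm_mul_le _ _) (norm_mul_le _ _))
  rw [norm_smul, Real.norm_eq_abs, abs_two] at h2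
  nlinarith

open scoped Matrix.Norms.Operator

/-- If some polynomial `f` maps `D t₀` to an orthogonal projection, then this projection extends to
a curve of orthogonal projections: with `K = f(D) + f(D)ᴴ - 1`, a self-adjoint curve that is an
involution at `t₀`, it is `(1 + K (K²)^(-1/2)) / 2`. -/
theorem exists_projection_curve {D : ℝ → Matrix (Fin n) (Fin n) ℂ} (hD : C.MemAt D t₀) {f : ℂ[X]}
    (hf : IsOrthProj (Polynomial.aeval (D t₀) f)) :
    ∃ P : ℝ → Matrix (Fin n) (Fin n) ℂ, C.MemAt P t₀ ∧ P t₀ = Polynomial.aeval (D t₀) f ∧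
      ∀ᶠ t in 𝓝 t₀, IsOrthProj (P t) ∧ InBicommutant (D t) (P t) := by
  let K : ℝ → Matrix (Fin n) (Fin n) ℂ := fun t =>
    Polynomial.aeval (D t) f + (Polynomial.aeval (D t) f)ᴴ - 1
  have hK : C.MemAt K t₀ :=
    ((hD.aeval f).add (hD.aeval f).conjTranspose).sub (FunctionClass.memAt_const 1)
  have hKs : ∀ t, (K t)ᴴ = K t := fun t => by
    simp only [K, conjTranspose_sub, conjTranspose_add, conjTranspose_conjTranspose,
      conjTranspose_one]
    rw [add_comm]
  have hKb : ∀ t, InBicommutant (D t) (K t) := fun t =>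
    ((inBicommutant_self.aeval f).add (inBicommutant_self.aeval f).conjTranspose).sub
      inBicommutant_one
  have hK0 : K t₀ = (2 : ℝ) • Polynomial.aeval (D t₀) f - 1 := by
    simp only [K]
    rw [hf.2, two_smul]
  have hW0 : K t₀ * K t₀ = 1 := by
    rw [hK0]
    simp only [two_smul, sub_mul, mul_sub, add_mul, mul_add, hf.1, one_mul, mul_one]
    abel
  obtain ⟨R, hR, hR0, hRW⟩ := (hK.mul hK).exists_inv_sqrt hW0
  have hR1 : ∀ᶠ t in 𝓝 t₀, ‖R t - 1‖ < 1 := by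
    have : ContinuousAt (fun t => ‖R t - 1‖) t₀ := (hR.continuousAt.sub continuousAt_const).norm
    exact this.eventually (gt_mem_nhds (by simp [hR0]))
  have hR2 : ∀ᶠ t in 𝓝 t₀, ‖(R t)ᴴ - 1‖ < 1 := by
    have : ContinuousAt (fun t => ‖(R t)ᴴ - 1‖) t₀ :=
      (hR.conjTranspose.continuousAt.sub continuousAt_const).norm
    exact this.eventually (gt_mem_nhds (by simp [hR0]))
  refine ⟨fun t => (1 / 2 : ℝ) • (1 + K t * R t),
    ((FunctionClass.memAt_const 1).add (hK.mul hR)).const_smul _, ?_, ?_⟩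
  · simp only [hR0, mul_one, hK0, add_sub_cancel, smul_smul]
    norm_num
  filter_upwards [hRW, hR1, hR2] with t hW h1 h2
  have hW' : R t * R t * (K t * K t) = 1 := mul_eq_one_comm.mp hW
  have hcomm : ∀ X, X * K t = K t * X → X * R t = R t * X := by
    intro X hX
    have hXW : X * (K t * K t) = K t * K t * X := by
      rw [← mul_assoc, hX, mul_assoc, hX, mul_assoc]
    have hXR : X * (R t * R t) = R t * R t * X := by
      calc X * (R t * R t) = R t * R t * (K t * K t) * X * (R t * R t) := by rw [hW', one_mul]
        _ = R t * R t * (X * (K t * K t)) * (R t * R t) := by rw [hXW]; simp only [mul_assoc]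
        _ = R t * R t * X * (K t * K t * (R t * R t)) := by simp only [mul_assoc]
        _ = R t * R t * X := by rw [hW, mul_one]
    refine sub_eq_zero.mp (eq_zero_of_mul_add_mul_eq_zero h1 h1 ?_)
    have : R t * (X * R t - R t * X) + (X * R t - R t * X) * R t =
        X * (R t * R t) - R t * R t * X := by noncomm_ring
    rw [this, hXR, sub_self]
  have hKR : K t * R t = R t * K t := hcomm _ rfl
  have hRs : (R t)ᴴ = R t := by
    refine (sub_eq_zero.mp (eq_zero_of_mul_add_mul_eq_zero h1 h2 ?_)).symm
    have h3 : (R t)ᴴ * (R t)ᴴ = R t * R t := by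
      have h4 : (R t)ᴴ * (R t)ᴴ * (K t * K t) = 1 := by
        have := congrArg Matrix.conjTranspose hW
        simpa [hKs t] using this
      calc (R t)ᴴ * (R t)ᴴ = (R t)ᴴ * (R t)ᴴ * (K t * K t * (R t * R t)) := by rw [hW, mul_one]
        _ = (R t)ᴴ * (R t)ᴴ * (K t * K t) * (R t * R t) := by simp only [mul_assoc]
        _ = R t * R t := by rw [h4, one_mul]
    have : R t * (R t - (R t)ᴴ) + (R t - (R t)ᴴ) * (R t)ᴴ = R t * R t - (R t)ᴴ * (R t)ᴴ := by
      noncomm_ring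
    rw [this, h3, sub_self]
  have hJ : K t * R t * (K t * R t) = 1 := by
    calc K t * R t * (K t * R t) = K t * (R t * K t) * R t := by simp only [mul_assoc]
      _ = K t * K t * (R t * R t) := by rw [← hKR]; simp only [mul_assoc]
      _ = 1 := hW
  refine ⟨⟨?_, ?_⟩, ?_⟩
  · rw [smul_mul_smul_comm, add_mul, mul_add, mul_add, hJ]
    simp only [one_mul, mul_one]
    have : (1 + K t * R t + (K t * R t + 1)) = (2 : ℝ) • (1 + K t * R t) := by
      rw [two_smul]
      abel
    rw [this, smul_smul]
    norm_num
  · rw [conjTranspose_smul, conjTranspose_add, conjTranspose_mul, hRs, hKs, ← hKR]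
    simp
  · intro X hX hX'
    exact ((inBicommutant_one.add ((hKb t).mul
      fun X hX hX' => hcomm X (hKb t X hX hX'))).real_smul _) X hX hX'

end Norm

end Bicommutant

/-! ### Local eigendecompositions -/

section Local

open Polynomial Matrix FunctionClass

open scoped Matrix.Norms.Operator

variable {C : FunctionClass} {n : ℕ} {t₀ : ℝ}

theorem eventually_eq_of_punctured {E : Type*} [TopologicalSpace E] [T2Space E] {F G : ℝ → E}
    (hF : ContinuousAt F t₀) (hG : ContinuousAt G t₀) (h : ∀ᶠ t in 𝓝[≠] t₀, F t = G t) :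
    ∀ᶠ t in 𝓝 t₀, F t = G t := by
  have h0 : F t₀ = G t₀ := tendsto_nhds_unique
    ((hF.tendsto.mono_left nhdsWithin_le_nhds).congr' h) (hG.tendsto.mono_left nhdsWithin_le_nhds)
  filter_upwards [eventually_nhdsWithin_iff.mp h] with t ht
  by_cases htt : t = t₀
  · rw [htt, h0]
  · exact ht htt

/-- The rank of a continuous curve of orthogonal projections is locally constant. -/
theorem eventually_trace_eq {Q : ℝ → Matrix (Fin n) (Fin n) ℂ} (hQ : C.MemAt Q t₀)
    (hproj : ∀ᶠ t in 𝓝 t₀, IsOrthProj (Q t)) : ∀ᶠ t in 𝓝 t₀, (Q t).trace = (Q t₀).trace := by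
  have hc : ContinuousAt (fun t => (Q t).trace) t₀ := hQ.trace.continuousAt
  filter_upwards [hproj, Metric.continuousAt_iff'.mp hc 1 one_pos] with t ht hd
  obtain ⟨m, hm, -⟩ := ht.exists_trace_eq
  obtain ⟨m₀, hm₀, -⟩ := hproj.self_of_nhds.exists_trace_eq
  rw [hm, hm₀, dist_eq_norm] at hd
  rw [hm, hm₀]
  have h1 : ‖(((m : ℤ) - (m₀ : ℤ) : ℤ) : ℂ)‖ < 1 := by
    push_cast
    exact hd
  rw [Complex.norm_intCast] at h1
  have h2 : |(m : ℤ) - (m₀ : ℤ)| < 1 := by exact_mod_cast h1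
  have h3 : (m : ℤ) = m₀ := by
    rw [Int.abs_lt_one_iff] at h2
    omega
  exact_mod_cast h3

/-- A splitting of `ℂ^n` near `t₀` into mutually orthogonal nonzero subspaces depending on `t` in a
`𝒞` fashion. For `t ≠ t₀` the projections are required to lie in the bicommutant of `A t` and its
adjoint; so every summand is a sum of eigenspaces of `A t`. -/
structure IsSplittingAt (C : FunctionClass) (A : ℝ → Matrix (Fin n) (Fin n) ℂ) (t₀ : ℝ)
    {ι : Type*} [Fintype ι] (Q : ι → ℝ → Matrix (Fin n) (Fin n) ℂ) : Prop where
  mem : ∀ i, C.MemAt (Q i) t₀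
  ne_zero : ∀ i, Q i t₀ ≠ 0
  proj : ∀ᶠ t in 𝓝 t₀, ∀ i, IsOrthProj (Q i t)
  orth : ∀ᶠ t in 𝓝 t₀, ∀ i j, i ≠ j → Q i t * Q j t = 0
  sum : ∀ᶠ t in 𝓝 t₀, ∑ i, Q i t = 1
  bicommutant : ∀ᶠ t in 𝓝[≠] t₀, ∀ i, InBicommutant (A t) (Q i t)

variable {A : ℝ → Matrix (Fin n) (Fin n) ℂ}

namespace IsSplittingAt

variable {ι : Type*} [Fintype ι] {Q : ι → ℝ → Matrix (Fin n) (Fin n) ℂ}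

theorem eventually_commute (hA : C.MemAt A t₀) (hnormal : ∀ t, A t * (A t)ᴴ = (A t)ᴴ * A t)
    (h : IsSplittingAt C A t₀ Q) (i : ι) : ∀ᶠ t in 𝓝 t₀, A t * Q i t = Q i t * A t := by
  refine eventually_eq_of_punctured (hA.mul (h.mem i)).continuousAt
    ((h.mem i).mul hA).continuousAt ?_
  filter_upwards [h.bicommutant] with t ht
  exact inBicommutant_self.commute (hnormal t) (ht i)

theorem card_le (h : IsSplittingAt C A t₀ Q) : Fintype.card ι ≤ n := by
  have hp := h.proj.self_of_nhds
  choose m hm _ using fun i => (hp i).exists_trace_eq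
  have hpos : ∀ i, 1 ≤ m i := by
    intro i
    by_contra hlt
    refine (hp i).trace_ne_zero (h.ne_zero i) ?_
    rw [hm i, Nat.lt_one_iff.mp (not_le.mp hlt), Nat.cast_zero]
  have hsum : ∑ i, m i = n := by
    have h1 := congrArg Matrix.trace h.sum.self_of_nhds
    rw [trace_sum, trace_one, Fintype.card_fin] at h1
    simp only [hm] at h1
    exact_mod_cast h1
  calc Fintype.card ι = ∑ _i : ι, 1 := by simp
    _ ≤ ∑ i, m i := Finset.sum_le_sum fun i _ => hpos i
    _ = n := hsum

/-- Refinement of a splitting: the summand `Q i₀` is divided into `P` and `Q i₀ - P`. -/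
theorem refine_option [DecidableEq ι] (h : IsSplittingAt C A t₀ Q) (i₀ : ι)
    {P : ℝ → Matrix (Fin n) (Fin n) ℂ} (hP : C.MemAt P t₀) (hP0 : P t₀ ≠ 0) (hP1 : P t₀ ≠ Q i₀ t₀)
    (hproj : ∀ᶠ t in 𝓝 t₀, IsOrthProj (P t)) (hPQ : ∀ᶠ t in 𝓝 t₀, P t * Q i₀ t = P t)
    (hQP : ∀ᶠ t in 𝓝 t₀, Q i₀ t * P t = P t)
    (hb : ∀ᶠ t in 𝓝[≠] t₀, InBicommutant (A t) (P t)) :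
    IsSplittingAt C A t₀ (fun o : Option ι => fun t =>
      o.elim (Q i₀ t - P t) fun i => if i = i₀ then P t else Q i t) where
  mem o := by
    cases o with
    | none => exact (h.mem i₀).sub hP
    | some i =>
      by_cases hi : i = i₀
      · simpa [hi] using hP
      · simpa [hi] using h.mem i
  ne_zero o := by
    cases o with
    | none => exact sub_ne_zero.mpr hP1.symm
    | some i =>
      by_cases hi : i = i₀
      · simpa [hi] using hP0
      · simpa [hi] using h.ne_zero i
  proj := by
    filter_upwards [h.proj, hproj, hPQ, hQP] with t h1 h2 h3 h4 o
    cases o with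
    | none => exact h2.sub_of_mul_eq (h1 i₀) h3 h4
    | some i =>
      by_cases hi : i = i₀
      · simpa [hi] using h2
      · simpa [hi] using h1 i
  orth := by
    filter_upwards [h.orth, h.proj, hproj, hPQ, hQP] with t h1 h2 h3 h4 h5
    have h6 : ∀ j, j ≠ i₀ → Q j t * P t = 0 := fun j hj => by
      rw [← h5, ← mul_assoc, h1 j i₀ hj, zero_mul]
    have h7 : ∀ j, j ≠ i₀ → P t * Q j t = 0 := fun j hj => by
      rw [← h4, mul_assoc, h1 i₀ j hj.symm, mul_zero]
    intro o o' hoo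
    cases o with
    | none =>
      cases o' with
      | none => exact absurd rfl hoo
      | some j =>
        by_cases hj : j = i₀
        · simp [hj, sub_mul, h5, h3.1]
        · simp [hj, sub_mul, h7 j hj, h1 i₀ j (Ne.symm hj)]
    | some i =>
      cases o' with
      | none =>
        by_cases hi : i = i₀
        · simp [hi, mul_sub, h4, h3.1]
        · simp [hi, mul_sub, h6 i hi, h1 i i₀ hi]
      | some j =>
        have hij : i ≠ j := fun hij => hoo (congrArg some hij)
        by_cases hi : i = i₀
        · have hj : j ≠ i₀ := fun hj => hij (hi.trans hj.symm)
          simp [hi, hj, h7 j hj]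
        · by_cases hj : j = i₀
          · simp [hi, hj, h6 i hi]
          · simp [hi, hj, h1 i j hij]
  sum := by
    filter_upwards [h.sum] with t h1
    rw [Fintype.sum_option]
    simp only [Option.elim]
    have h2 : ∑ i, (if i = i₀ then P t else Q i t) = P t + (∑ i, Q i t - Q i₀ t) := by
      rw [← Finset.add_sum_erase _ _ (Finset.mem_univ i₀),
        ← Finset.add_sum_erase _ (fun i => Q i t) (Finset.mem_univ i₀), add_sub_cancel_left,
        if_pos rfl]
      congr 1
      exact Finset.sum_congr rfl fun i hi => if_neg (Finset.ne_of_mem_erase hi)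
    rw [h2, h1]
    abel
  bicommutant := by
    filter_upwards [h.bicommutant, hb] with t h1 h2 o
    cases o with
    | none => exact (h1 i₀).sub h2
    | some i =>
      by_cases hi : i = i₀
      · simpa [hi] using h2
      · simpa [hi] using h1 i

/-- Either `A` is scalar on a given summand of a splitting near `t₀`, or this summand can be split
further: after division by the largest possible power of `t - t₀`, the trace-free part of `A` on the
summand has at least two distinct eigenvalues at `t₀`. -/
theorem scalar_or_refinement (hA : C.MemAt A t₀) (hnormal : ∀ t, A t * (A t)ᴴ = (A t)ᴴ * A t)
    (hnf : IsNormallyNonflatAt n (fun t => (A t).charpoly) t₀) (h : IsSplittingAt C A t₀ Q)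
    (i₀ : ι) :
    (∃ l : ℝ → ℂ, C.MemAt l t₀ ∧ ∀ᶠ t in 𝓝 t₀, A t * Q i₀ t = l t • Q i₀ t) ∨
      ∃ Q' : Option ι → ℝ → Matrix (Fin n) (Fin n) ℂ, IsSplittingAt C A t₀ Q' := by
  classical
  have hQ := h.mem i₀
  have hproj : ∀ᶠ t in 𝓝 t₀, IsOrthProj (Q i₀ t) := h.proj.mono fun t ht => ht i₀
  have htr := eventually_trace_eq hQ hproj
  have htr0 : (Q i₀ t₀).trace ≠ 0 := hproj.self_of_nhds.trace_ne_zero (h.ne_zero i₀)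
  have hcomm := h.eventually_commute hA hnormal i₀
  let l : ℝ → ℂ := fun t => ((Q i₀ t₀).trace)⁻¹ * (A t * Q i₀ t).trace
  have hl : C.MemAt l t₀ := (memAt_const _).mul (hA.mul hQ).trace
  have hltr : ∀ᶠ t in 𝓝 t₀, l t * (Q i₀ t).trace = (A t * Q i₀ t).trace := by
    filter_upwards [htr] with t ht
    rw [ht, mul_comm, ← mul_assoc, mul_inv_cancel₀ htr0, one_mul]
  let B : ℝ → Matrix (Fin n) (Fin n) ℂ := fun t => A t * Q i₀ t - l t • Q i₀ t
  have hB : C.MemAt B t₀ := (hA.mul hQ).sub (hl.complex_smul hQ)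
  obtain ⟨φ, c, K, p, hc, hK, hlow, hupp⟩ := exists_lower_bound_of_nonflat hA hnf
  have hφB : ∀ᶠ t in 𝓝 t₀, B t ≠ 0 → φ t ≤ (K * 4) * ‖B t‖ ^ 2 := by
    filter_upwards [hupp, hproj, hcomm, hltr] with t h1 h2 h3 h4 h5
    obtain ⟨z, hz, w, hw, hzw, hle⟩ := exists_roots_norm_sub_le (hnormal t) h2 h3 h4 h5
    calc φ t ≤ K * ‖z - w‖ ^ 2 := h1 z hz w hw hzw
      _ ≤ K * (2 * ‖B t‖) ^ 2 := by gcongr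
      _ = (K * 4) * ‖B t‖ ^ 2 := by ring
  rcases hB.eventually_zero_or_exists_pow_smul hc hlow hφB with hz | ⟨q, D, hD, hD0, hBD⟩
  · exact Or.inl ⟨l, hl, hz.mono fun t ht => sub_eq_zero.mp ht⟩
  right
  have hDB : ∀ᶠ t in 𝓝[≠] t₀, D t = ((t - t₀) ^ q)⁻¹ • B t := by
    filter_upwards [nhdsWithin_le_nhds hBD, self_mem_nhdsWithin] with t h1 h2
    rw [h1, inv_smul_smul₀ (pow_ne_zero _ (sub_ne_zero.mpr h2))]
  have hDb : ∀ᶠ t in 𝓝[≠] t₀, InBicommutant (A t) (D t) := by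
    filter_upwards [hDB, h.bicommutant] with t h1 h2
    rw [h1]
    exact ((inBicommutant_self.mul (h2 i₀)).sub ((h2 i₀).smul _)).real_smul _
  have hDn : ∀ᶠ t in 𝓝 t₀, D t * (D t)ᴴ = (D t)ᴴ * D t := by
    refine eventually_eq_of_punctured (hD.mul hD.conjTranspose).continuousAt
      (hD.conjTranspose.mul hD).continuousAt ?_
    filter_upwards [hDb] with t ht
    exact ht.commute (hnormal t) ht.conjTranspose
  have hDQ : ∀ᶠ t in 𝓝 t₀, D t * Q i₀ t = D t := by
    refine eventually_eq_of_punctured (hD.mul hQ).continuousAt hD.continuousAt ?_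
    filter_upwards [hDB, nhdsWithin_le_nhds hproj] with t h1 h2
    simp only [h1, B, smul_mul_assoc, sub_mul, mul_assoc, h2.1]
  have hDtr : ∀ᶠ t in 𝓝 t₀, (D t).trace = 0 := by
    refine eventually_eq_of_punctured hD.trace.continuousAt continuousAt_const ?_
    filter_upwards [hDB, nhdsWithin_le_nhds hltr] with t h1 h2
    simp only [h1, B, trace_smul, trace_sub, smul_eq_mul, h2, sub_self, smul_zero]
  obtain ⟨f, hf, hf0, hf1⟩ := exists_polynomial_splitting hDn.self_of_nhds hproj.self_of_nhds
    hDQ.self_of_nhds hD0 hDtr.self_of_nhds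
  obtain ⟨P, hP, hP0, hPp⟩ := exists_projection_curve hD hf
  have hPb : ∀ᶠ t in 𝓝[≠] t₀, InBicommutant (A t) (P t) := by
    filter_upwards [hDb, nhdsWithin_le_nhds hPp] with t h1 h2
    exact h1.trans h2.2
  have hPQ : ∀ᶠ t in 𝓝 t₀, P t * Q i₀ t = Q i₀ t * P t := by
    refine eventually_eq_of_punctured (hP.mul hQ).continuousAt (hQ.mul hP).continuousAt ?_
    filter_upwards [hPb, h.bicommutant] with t h1 h2
    exact h1.commute (hnormal t) (h2 i₀)
  refine ⟨_, h.refine_option i₀ (hP.mul hQ) (by rwa [hP0]) (by rwa [hP0]) ?_ ?_ ?_ ?_⟩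
  · filter_upwards [hPp, hproj, hPQ] with t h1 h2 h3
    exact h1.1.mul_of_commute h2 h3
  · filter_upwards [hproj] with t h2
    rw [mul_assoc, h2.1]
  · filter_upwards [hproj, hPQ] with t h2 h3
    rw [h3, ← mul_assoc, h2.1]
  · filter_upwards [hPb, h.bicommutant] with t h1 h2
    exact h1.mul (h2 i₀)

end IsSplittingAt

/-- A maximal splitting consists of projections onto eigenspaces. -/
theorem exists_scalar_splitting (hn : 0 < n) (hA : C.MemAt A t₀)
    (hnormal : ∀ t, A t * (A t)ᴴ = (A t)ᴴ * A t)
    (hnf : IsNormallyNonflatAt n (fun t => (A t).charpoly) t₀) :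
    ∃ (ι : Type) (_ : Fintype ι) (Q : ι → ℝ → Matrix (Fin n) (Fin n) ℂ) (l : ι → ℝ → ℂ),
      IsSplittingAt C A t₀ Q ∧ (∀ i, C.MemAt (l i) t₀) ∧
      ∀ i, ∀ᶠ t in 𝓝 t₀, A t * Q i t = l i t • Q i t := by
  -- Induction on `n - card ι`: a splitting has at most `n` summands.
  suffices key : ∀ (m : ℕ) (ι : Type) (_ : Fintype ι) (Q : ι → ℝ → Matrix (Fin n) (Fin n) ℂ),
      IsSplittingAt C A t₀ Q → n = Fintype.card ι + m →
      ∃ (ι : Type) (_ : Fintype ι) (Q : ι → ℝ → Matrix (Fin n) (Fin n) ℂ) (l : ι → ℝ → ℂ),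
        IsSplittingAt C A t₀ Q ∧ (∀ i, C.MemAt (l i) t₀) ∧
        ∀ i, ∀ᶠ t in 𝓝 t₀, A t * Q i t = l i t • Q i t by
    have : Nonempty (Fin n) := ⟨⟨0, hn⟩⟩
    refine key (n - 1) Unit inferInstance (fun _ _ => 1) ?_ (by simp; omega)
    exact
      { mem := fun _ => memAt_const 1
        ne_zero := fun _ => one_ne_zero
        proj := by simp [IsOrthProj]
        orth := Filter.Eventually.of_forall fun t i j hij => absurd (Subsingleton.elim i j) hij
        sum := by simp
        bicommutant := Filter.Eventually.of_forall fun t _ => inBicommutant_one }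
  intro m
  induction m with
  | zero =>
    intro ι _ Q h hcard
    have hsc : ∀ i, ∃ l : ℝ → ℂ, C.MemAt l t₀ ∧ ∀ᶠ t in 𝓝 t₀, A t * Q i t = l t • Q i t := by
      intro i
      rcases h.scalar_or_refinement hA hnormal hnf i with h1 | ⟨Q', hQ'⟩
      · exact h1
      · have := hQ'.card_le
        rw [Fintype.card_option] at this
        omega
    choose l hl hlQ using hsc
    exact ⟨ι, inferInstance, Q, l, h, hl, hlQ⟩
  | succ m ih =>
    intro ι _ Q h hcard
    by_cases hsc : ∀ i, ∃ l : ℝ → ℂ, C.MemAt l t₀ ∧ ∀ᶠ t in 𝓝 t₀, A t * Q i t = l t • Q i t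
    · choose l hl hlQ using hsc
      exact ⟨ι, inferInstance, Q, l, h, hl, hlQ⟩
    · obtain ⟨i, hi⟩ := not_forall.mp hsc
      obtain ⟨Q', hQ'⟩ := (h.scalar_or_refinement hA hnormal hnf i).resolve_left hi
      exact ih (Option ι) inferInstance Q' hQ' (by rw [Fintype.card_option]; omega)

/-- The family `x` of pairs `(μ_i, P_i)` decomposes the matrix `A`: the `P_i` are nonzero, mutually
orthogonal projections with sum `1`, and `A` acts on the range of `P_i` as the scalar `μ_i`. -/
def IsEigenDecomposition {ι : Type*} [Fintype ι] (A : Matrix (Fin n) (Fin n) ℂ)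
    (x : ι → ℂ × Matrix (Fin n) (Fin n) ℂ) : Prop :=
  (∀ i, IsOrthProj (x i).2 ∧ A * (x i).2 = (x i).1 • (x i).2 ∧ (x i).2 ≠ 0) ∧
    (∀ i j, i ≠ j → (x i).2 * (x j).2 = 0) ∧ ∑ i, (x i).2 = 1

/-- Near `t₀` the family `F` is an eigendecomposition of `A` of class `𝒞`, with pairwise distinct
eigenvalues for `t ≠ t₀`. -/
structure IsEigenSystemAt (C : FunctionClass) (A : ℝ → Matrix (Fin n) (Fin n) ℂ) {ι : Type*}
    [Fintype ι] (F : ℝ → ι → ℂ × Matrix (Fin n) (Fin n) ℂ) (t₀ : ℝ) : Prop where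
  mem_value : ∀ i, C.MemAt (fun t => (F t i).1) t₀
  mem_proj : ∀ i, C.MemAt (fun t => (F t i).2) t₀
  decomposition : ∀ᶠ t in 𝓝 t₀, IsEigenDecomposition (A t) (F t)
  injective : ∀ᶠ t in 𝓝[≠] t₀, Function.Injective fun i => (F t i).1

/-- If `λ_i = λ_j` at some `t ≠ t₀`, then all operators `P_i Y P_j` commute with `A t` and its
adjoint, hence with `P_i`; this forces them to vanish. -/
theorem exists_isEigenSystemAt (hn : 0 < n) (hA : C.MemAt A t₀)
    (hnormal : ∀ t, A t * (A t)ᴴ = (A t)ᴴ * A t)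
    (hnf : IsNormallyNonflatAt n (fun t => (A t).charpoly) t₀) :
    ∃ (ι : Type) (_ : Fintype ι) (F : ℝ → ι → ℂ × Matrix (Fin n) (Fin n) ℂ),
      IsEigenSystemAt C A F t₀ := by
  obtain ⟨ι, _, Q, l, hQ, hl, hlQ⟩ := exists_scalar_splitting hn hA hnormal hnf
  have hne : ∀ᶠ t in 𝓝 t₀, ∀ i, Q i t ≠ 0 :=
    Filter.eventually_all.mpr fun i => (hQ.mem i).continuousAt.eventually_ne (hQ.ne_zero i)
  have hlQ' := Filter.eventually_all.mpr hlQ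
  refine ⟨ι, inferInstance, fun t i => (l i t, Q i t), hl, hQ.mem, ?_, ?_⟩
  · filter_upwards [hQ.proj, hQ.orth, hQ.sum, hne, hlQ'] with t h1 h2 h3 h4 h5
    exact ⟨fun i => ⟨h1 i, h5 i, h4 i⟩, h2, h3⟩
  · filter_upwards [nhdsWithin_le_nhds hQ.proj, nhdsWithin_le_nhds hQ.orth,
      nhdsWithin_le_nhds hne, nhdsWithin_le_nhds hlQ', hQ.bicommutant] with t h1 h2 h4 h5 h6 i j hij
    by_contra hne
    have hij : l i t = l j t := hij
    have hQA : ∀ i, Q i t * A t = l i t • Q i t := fun i => by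
      rw [← h5 i]
      exact ((h6 i).commute (hnormal t) inBicommutant_self)
    have hAQ' : ∀ i, (A t)ᴴ * Q i t = star (l i t) • Q i t := fun i => by
      simpa [(h1 i).2] using congrArg Matrix.conjTranspose (hQA i)
    have hQA' : ∀ i, Q i t * (A t)ᴴ = star (l i t) • Q i t := fun i => by
      simpa [(h1 i).2] using congrArg Matrix.conjTranspose (h5 i)
    have hzero : ∀ Y : Matrix (Fin n) (Fin n) ℂ, Q i t * Y * Q j t = 0 := by
      intro Y
      have h7 : Q i t * Y * Q j t * Q i t = Q i t * (Q i t * Y * Q j t) := by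
        refine h6 i _ ?_ ?_
        · rw [mul_assoc, hQA j, ← mul_assoc (A t) _ (Q j t), ← mul_assoc (A t) _ Y, h5 i, hij]
          simp only [mul_smul_comm, smul_mul_assoc, mul_assoc]
        · rw [mul_assoc, hQA' j, ← mul_assoc (A t)ᴴ _ (Q j t), ← mul_assoc (A t)ᴴ _ Y, hAQ' i, hij]
          simp only [mul_smul_comm, smul_mul_assoc, mul_assoc]
      rw [mul_assoc _ (Q j t), h2 j i (Ne.symm hne), mul_zero, ← mul_assoc, ← mul_assoc,
        (h1 i).1] at h7
      exact h7.symm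
    obtain ⟨a, b, hab⟩ : ∃ a b, Q i t a b ≠ 0 := by
      by_contra! hc
      exact h4 i (by ext a b; exact hc a b)
    obtain ⟨a', b', hab'⟩ : ∃ a b, Q j t a b ≠ 0 := by
      by_contra! hc
      exact h4 j (by ext a b; exact hc a b)
    have h8 := congrFun (congrFun (hzero (Matrix.single b a' 1)) a) b'
    rw [Matrix.mul_apply, Finset.sum_eq_single a'] at h8
    · rw [Matrix.mul_single_apply_same, mul_one] at h8
      exact mul_ne_zero hab hab' h8
    · intro x _ hx
      rw [Matrix.mul_single_apply_of_ne _ _ _ _ _ hx, zero_mul]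
    · simp

end Local

/-! ### Gluing of local solutions along the line -/

section Gluing

variable {X : Type*} {V : (ℝ → X) → ℝ → Prop}

/-- Two local solutions on a preconnected set that agree near one point agree everywhere, provided
that agreement of germs is a closed condition. -/
theorem eventuallyEq_of_isPreconnected
    (huniq : ∀ F G t, V F t → V G t → (∃ᶠ s in 𝓝 t, F =ᶠ[𝓝 s] G) → F =ᶠ[𝓝 t] G)
    {S : Set ℝ} (hS : IsPreconnected S) {F G : ℝ → X} (hF : ∀ t ∈ S, V F t) (hG : ∀ t ∈ S, V G t)
    {t₀ : ℝ} (ht₀ : t₀ ∈ S) (h : F =ᶠ[𝓝 t₀] G) : ∀ t ∈ S, F =ᶠ[𝓝 t] G := by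
  refine hS.subset_of_closure_inter_subset (u := {t | F =ᶠ[𝓝 t] G}) ?_ ⟨t₀, ht₀, h⟩ ?_
  · exact isOpen_iff_eventually.mpr fun t ht => ht.eventually_nhds
  · rintro t ⟨ht, htS⟩
    exact huniq F G t (hF t htS) (hG t htS) (mem_closure_iff_frequently.mp ht)

/-- A local system on the line has a global section: if the local solutions, described by the
predicate `V` on germs, can be continued uniquely within a neighborhood of each point that is
independent of the solution, then there is a global solution. -/
theorem exists_global_of_local
    (hcongr : ∀ F G t, V F t → F =ᶠ[𝓝 t] G → V G t)
    (hopen : ∀ F t, V F t → ∀ᶠ s in 𝓝 t, V F s)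
    (huniq : ∀ F G t, V F t → V G t → (∃ᶠ s in 𝓝 t, F =ᶠ[𝓝 s] G) → F =ᶠ[𝓝 t] G)
    (hext : ∀ t₀, ∃ J : Set ℝ, IsOpen J ∧ IsPreconnected J ∧ t₀ ∈ J ∧ ∀ t₁ ∈ J, ∀ G, V G t₁ →
      ∃ F, (∀ t ∈ J, V F t) ∧ F =ᶠ[𝓝 t₁] G)
    {F₀ : ℝ → X} (hF₀ : V F₀ 0) : ∃ F, ∀ t, V F t := by
  classical
  let S : Set ℝ := {b | ∃ (O : Set ℝ) (F : ℝ → X), IsOpen O ∧ IsPreconnected O ∧ 0 ∈ O ∧ b ∈ O ∧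
    (∀ t ∈ O, V F t) ∧ F =ᶠ[𝓝 0] F₀}
  have h0 : (0 : ℝ) ∈ S := by
    obtain ⟨ε, hε, hb⟩ := Metric.eventually_nhds_iff_ball.mp (hopen _ _ hF₀)
    exact ⟨Metric.ball 0 ε, F₀, Metric.isOpen_ball, (convex_ball _ _).isPreconnected,
      Metric.mem_ball_self hε, Metric.mem_ball_self hε, hb, Filter.EventuallyEq.rfl⟩
  have hSopen : IsOpen S := by
    refine isOpen_iff_mem_nhds.mpr ?_
    rintro b ⟨O, F, hO, hOc, hO0, hOb, hF⟩
    exact Filter.mem_of_superset (hO.mem_nhds hOb) fun b' hb' => ⟨O, F, hO, hOc, hO0, hb', hF⟩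
  have hinter : ∀ {O J : Set ℝ}, IsPreconnected O → IsPreconnected J → IsPreconnected (O ∩ J) :=
    fun hO hJ => isPreconnected_iff_ordConnected.mpr
      ((isPreconnected_iff_ordConnected.mp hO).inter (isPreconnected_iff_ordConnected.mp hJ))
  have hS : (Set.univ : Set ℝ) ⊆ S := by
    refine isPreconnected_univ.subset_of_closure_inter_subset hSopen ⟨0, trivial, h0⟩ ?_
    rintro b ⟨hb, -⟩
    obtain ⟨J, hJ, hJc, hbJ, hJext⟩ := hext b
    obtain ⟨b₁, hb₁J, O, F, hO, hOc, hO0, hOb, hF, hF0⟩ := mem_closure_iff.mp hb J hJ hbJ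
    obtain ⟨G, hG, hGF⟩ := hJext b₁ hb₁J F (hF b₁ hOb)
    have hagree := eventuallyEq_of_isPreconnected huniq (hinter hOc hJc) (fun t ht => hF t ht.1)
      (fun t ht => hG t ht.2) ⟨hOb, hb₁J⟩ hGF.symm
    let H : ℝ → X := fun t => if t ∈ O then F t else G t
    have hHF : ∀ t ∈ O, F =ᶠ[𝓝 t] H := fun t ht => by
      filter_upwards [hO.mem_nhds ht] with s hs
      simp [H, hs]
    have hHG : ∀ t ∈ J, G =ᶠ[𝓝 t] H := fun t ht => by
      filter_upwards [hJ.mem_nhds ht] with s hs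
      by_cases hsO : s ∈ O
      · simp only [H, hsO, if_true]
        exact ((hagree s ⟨hsO, hs⟩).self_of_nhds).symm
      · simp [H, hsO]
    refine ⟨O ∪ J, H, hO.union hJ, hOc.union b₁ hOb hb₁J hJc, Or.inl hO0, Or.inr hbJ, ?_,
      (hHF 0 hO0).symm.trans hF0⟩
    rintro t (ht | ht)
    · exact hcongr _ _ _ (hF t ht) (hHF t ht)
    · exact hcongr _ _ _ (hG t ht) (hHG t ht)
  choose O F hO hOc hO0 hOb hF hF0 using fun b => hS (Set.mem_univ b)
  refine ⟨fun t => F t t, fun t => hcongr (F t) _ t (hF t t (hOb t)) ?_⟩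
  filter_upwards [(hO t).mem_nhds (hOb t)] with s hs
  exact (eventuallyEq_of_isPreconnected huniq (hinter (hOc t) (hOc s)) (fun r hr => hF t r hr.1)
    (fun r hr => hF s r hr.2) ⟨hO0 t, hO0 s⟩ ((hF0 t).trans (hF0 s).symm) s
    ⟨hs, hOb s⟩).self_of_nhds

end Gluing

/-! ### Uniqueness of eigendecompositions up to relabeling -/

section Relabeling

open Matrix FunctionClass

open scoped Matrix.Norms.Operator

variable {C : FunctionClass} {n : ℕ} {t₀ : ℝ} {A : ℝ → Matrix (Fin n) (Fin n) ℂ}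
variable {ι κ : Type*} [Fintype ι] [Fintype κ]

theorem IsEigenDecomposition.comp_equiv {B : Matrix (Fin n) (Fin n) ℂ}
    {x : κ → ℂ × Matrix (Fin n) (Fin n) ℂ} (h : IsEigenDecomposition B x) (σ : ι ≃ κ) :
    IsEigenDecomposition B (x ∘ σ) :=
  ⟨fun i => h.1 (σ i), fun _ _ hij => h.2.1 _ _ (σ.injective.ne hij),
    (σ.sum_comp fun k => (x k).2).trans h.2.2⟩

theorem IsEigenDecomposition.mul_eq_smul {B : Matrix (Fin n) (Fin n) ℂ}
    {x : ι → ℂ × Matrix (Fin n) (Fin n) ℂ} (h : IsEigenDecomposition B x) (i : ι) :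
    (x i).2 * B = (x i).1 • (x i).2 := by
  classical
  have h1 : ∀ j, (x i).2 * (B * (x j).2) = if j = i then (x i).1 • (x i).2 else 0 := by
    intro j
    rw [(h.1 j).2.1, mul_smul_comm]
    split_ifs with hj
    · rw [hj, (h.1 i).1.1]
    · rw [h.2.1 i j (Ne.symm hj), smul_zero]
  calc (x i).2 * B = ∑ j, (x i).2 * (B * (x j).2) := by
        rw [← Finset.mul_sum, ← Finset.mul_sum, h.2.2, mul_one]
    _ = (x i).1 • (x i).2 := by simp [h1]

/-- Projections of two eigendecompositions for different eigenvalues are orthogonal. -/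
theorem IsEigenDecomposition.mul_eq_zero {B : Matrix (Fin n) (Fin n) ℂ}
    {x : ι → ℂ × Matrix (Fin n) (Fin n) ℂ} {y : κ → ℂ × Matrix (Fin n) (Fin n) ℂ}
    (hx : IsEigenDecomposition B x) (hy : IsEigenDecomposition B y) {i : ι} {k : κ}
    (h : (x i).1 ≠ (y k).1) : (x i).2 * (y k).2 = 0 := by
  have h1 : (x i).1 • ((x i).2 * (y k).2) = (y k).1 • ((x i).2 * (y k).2) := by
    rw [← smul_mul_assoc, ← hx.mul_eq_smul i, mul_assoc, (hy.1 k).2.1, mul_smul_comm]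
  rw [← sub_eq_zero, ← sub_smul] at h1
  exact (smul_eq_zero.mp h1).resolve_left (sub_ne_zero.mpr h)

theorem IsEigenDecomposition.proj_eq {B : Matrix (Fin n) (Fin n) ℂ}
    {x : ι → ℂ × Matrix (Fin n) (Fin n) ℂ} {y : κ → ℂ × Matrix (Fin n) (Fin n) ℂ}
    (hx : IsEigenDecomposition B x) (hy : IsEigenDecomposition B y)
    (hxi : Function.Injective fun i => (x i).1) (hyi : Function.Injective fun k => (y k).1)
    {i : ι} {k : κ} (h : (x i).1 = (y k).1) : (x i).2 = (y k).2 := by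
  have h1 : (x i).2 * (y k).2 = (x i).2 := by
    conv_rhs => rw [← mul_one (x i).2, ← hy.2.2, Finset.mul_sum]
    refine (Finset.sum_eq_single_of_mem k (Finset.mem_univ k) fun j _ hj =>
      hx.mul_eq_zero (i := i) (k := j) hy ?_).symm
    rw [h]
    exact fun hc => hj (hyi hc).symm
  have h2 : (x i).2 * (y k).2 = (y k).2 := by
    conv_rhs => rw [← one_mul (y k).2, ← hx.2.2, Finset.sum_mul]
    refine (Finset.sum_eq_single_of_mem i (Finset.mem_univ i) fun j _ hj =>
      hx.mul_eq_zero (i := j) (k := k) hy ?_).symm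
    rw [← h]
    exact fun hc => hj (hxi hc)
  rw [← h1, h2]

theorem IsEigenDecomposition.exists_mul_ne_zero {B : Matrix (Fin n) (Fin n) ℂ}
    {x : ι → ℂ × Matrix (Fin n) (Fin n) ℂ} {y : κ → ℂ × Matrix (Fin n) (Fin n) ℂ}
    (hx : IsEigenDecomposition B x) (hy : IsEigenDecomposition B y) (i : ι) :
    ∃ k, (x i).2 * (y k).2 ≠ 0 := by
  by_contra! h
  refine (hx.1 i).2.2 ?_
  rw [← mul_one (x i).2, ← hy.2.2, Finset.mul_sum, Finset.sum_eq_zero fun k _ => h k]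

namespace IsEigenSystemAt

theorem congr {F G : ℝ → ι → ℂ × Matrix (Fin n) (Fin n) ℂ} (h : IsEigenSystemAt C A F t₀)
    (hFG : F =ᶠ[𝓝 t₀] G) : IsEigenSystemAt C A G t₀ where
  mem_value i := (h.mem_value i).congr (hFG.mono fun t ht => by simp only [ht])
  mem_proj i := (h.mem_proj i).congr (hFG.mono fun t ht => by simp only [ht])
  decomposition := by
    filter_upwards [h.decomposition, hFG] with t h1 h2
    rwa [← h2]
  injective := by
    filter_upwards [h.injective, nhdsWithin_le_nhds hFG] with t h1 h2
    rwa [← h2]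

theorem comp_equiv {F : ℝ → κ → ℂ × Matrix (Fin n) (Fin n) ℂ} (h : IsEigenSystemAt C A F t₀)
    (σ : ι ≃ κ) : IsEigenSystemAt C A (fun t => F t ∘ σ) t₀ where
  mem_value i := h.mem_value (σ i)
  mem_proj i := h.mem_proj (σ i)
  decomposition := h.decomposition.mono fun _ ht => ht.comp_equiv σ
  injective := h.injective.mono fun _ ht => ht.comp σ.injective

theorem eventually {F : ℝ → ι → ℂ × Matrix (Fin n) (Fin n) ℂ} (h : IsEigenSystemAt C A F t₀) :
    ∀ᶠ t in 𝓝 t₀, IsEigenSystemAt C A F t := by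
  have h1 := Filter.eventually_all.mpr fun i => (h.mem_value i).eventually
  have h2 := Filter.eventually_all.mpr fun i => (h.mem_proj i).eventually
  filter_upwards [h1, h2, h.decomposition.eventually_nhds,
    (eventually_nhdsWithin_iff.mp h.injective).eventually_nhds] with t h1 h2 h3 h4
  refine ⟨h1, h2, h3, ?_⟩
  by_cases ht : t = t₀
  · rw [ht]
    exact h.injective
  · have h5 : ∀ᶠ s in 𝓝 t, s ≠ t₀ := eventually_ne_nhds ht
    exact nhdsWithin_le_nhds (by filter_upwards [h4, h5] with s h6 h7 using h6 h7)

/-- Two eigensystems agree near `t₀` up to relabeling. The labels are matched at `t₀` by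
nonvanishing of the products of the projections, which are themselves projections for `t ≠ t₀`, so
that by continuity they vanish either identically near `t₀` or nowhere. -/
theorem exists_equiv {F : ℝ → ι → ℂ × Matrix (Fin n) (Fin n) ℂ}
    {G : ℝ → κ → ℂ × Matrix (Fin n) (Fin n) ℂ} (hF : IsEigenSystemAt C A F t₀)
    (hG : IsEigenSystemAt C A G t₀) : ∃ σ : ι ≃ κ, F =ᶠ[𝓝 t₀] fun t => G t ∘ σ := by
  have hcont : ∀ i k, ContinuousAt (fun t => (F t i).2 * (G t k).2) t₀ := fun i k =>
    ((hF.mem_proj i).mul (hG.mem_proj k)).continuousAt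
  have hmatch : ∀ᶠ t in 𝓝[≠] t₀, ∀ i k, (F t i).1 = (G t k).1 ↔ (F t₀ i).2 * (G t₀ k).2 ≠ 0 := by
    refine Filter.eventually_all.mpr fun i => Filter.eventually_all.mpr fun k => ?_
    have hiff : ∀ᶠ t in 𝓝[≠] t₀, ((F t i).1 = (G t k).1 → (F t i).2 * (G t k).2 = (F t i).2) ∧
        ((F t i).1 ≠ (G t k).1 → (F t i).2 * (G t k).2 = 0) := by
      filter_upwards [nhdsWithin_le_nhds hF.decomposition, nhdsWithin_le_nhds hG.decomposition,
        hF.injective, hG.injective] with t h1 h2 h3 h4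
      refine ⟨fun h => ?_, fun h => h1.mul_eq_zero h2 h⟩
      rw [← h1.proj_eq h2 h3 h4 h, (h1.1 i).1.1]
    by_cases h0 : (F t₀ i).2 * (G t₀ k).2 = 0
    · have hlt : ∀ᶠ t in 𝓝 t₀, ‖(F t i).2 * (G t k).2‖ < 1 :=
        (hcont i k).norm.eventually (gt_mem_nhds (by simp [h0]))
      filter_upwards [hiff, nhdsWithin_le_nhds hlt, nhdsWithin_le_nhds hF.decomposition]
        with t h1 h2 h3
      refine ⟨fun h => ?_, fun h => absurd h0 h⟩
      rw [h1.1 h] at h2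
      exact absurd ((h3.1 i).1.one_le_norm (h3.1 i).2.2) (not_le.mpr h2)
    · have hne := (hcont i k).eventually_ne h0
      filter_upwards [hiff, nhdsWithin_le_nhds hne] with t h1 h2
      refine ⟨fun _ => h0, fun _ => ?_⟩
      by_contra h
      exact h2 (h1.2 h)
  choose f hf using hF.decomposition.self_of_nhds.exists_mul_ne_zero
    hG.decomposition.self_of_nhds
  have hbij : Function.Bijective f := by
    obtain ⟨t, h1, h2, h3, h4, h5⟩ := (hmatch.and (hF.injective.and (hG.injective.and
      ((hF.decomposition.filter_mono nhdsWithin_le_nhds).and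
        (hG.decomposition.filter_mono nhdsWithin_le_nhds))))).exists
    refine ⟨fun i j hij => h2 ?_, fun k => ?_⟩
    · change (F t i).1 = (F t j).1
      rw [(h1 i (f i)).mpr (hf i), hij, (h1 j (f j)).mpr (hf j)]
    · obtain ⟨i, hi⟩ := h5.exists_mul_ne_zero h4 k
      have h6 : (F t i).1 = (G t k).1 := by
        by_contra h
        exact hi (h5.mul_eq_zero h4 (Ne.symm h))
      exact ⟨i, h3 (show (G t (f i)).1 = (G t k).1 by rw [← (h1 i (f i)).mpr (hf i), h6])⟩
  refine ⟨Equiv.ofBijective f hbij, ?_⟩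
  have hpunct : ∀ᶠ t in 𝓝[≠] t₀, ∀ i, (F t i).1 = (G t (f i)).1 ∧ (F t i).2 = (G t (f i)).2 := by
    filter_upwards [hmatch, hF.injective, hG.injective, nhdsWithin_le_nhds hF.decomposition,
      nhdsWithin_le_nhds hG.decomposition] with t h1 h2 h3 h4 h5 i
    have h6 := (h1 i (f i)).mpr (hf i)
    exact ⟨h6, h4.proj_eq h5 h2 h3 h6⟩
  have hall := Filter.eventually_all.mpr fun i => (eventually_eq_of_punctured
    (hF.mem_value i).continuousAt (hG.mem_value (f i)).continuousAt
    (hpunct.mono fun t ht => (ht i).1)).and (eventually_eq_of_punctured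
    (hF.mem_proj i).continuousAt (hG.mem_proj (f i)).continuousAt
    (hpunct.mono fun t ht => (ht i).2))
  filter_upwards [hall] with t ht
  funext i
  exact Prod.ext (ht i).1 (ht i).2

theorem eventuallyEq_of_frequently {F G : ℝ → ι → ℂ × Matrix (Fin n) (Fin n) ℂ}
    (hF : IsEigenSystemAt C A F t₀) (hG : IsEigenSystemAt C A G t₀)
    (h : ∃ᶠ s in 𝓝 t₀, F =ᶠ[𝓝 s] G) : F =ᶠ[𝓝 t₀] G := by
  obtain ⟨σ, hσ⟩ := hF.exists_equiv hG
  obtain ⟨s, hs, h1, h2⟩ := (h.and_eventually (hσ.eventually_nhds.and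
    (eventually_nhdsWithin_iff.mp hG.injective).eventually_nhds)).exists
  -- The coincidence set is open, so it also contains points different from `t₀`.
  have h3 : ∀ᶠ r in 𝓝[≠] s, r ≠ t₀ := by
    by_cases hst : s = t₀
    · rw [hst]
      exact self_mem_nhdsWithin
    · exact nhdsWithin_le_nhds (eventually_ne_nhds hst)
  obtain ⟨r, h4, h5, h6, h7⟩ := ((hs.filter_mono nhdsWithin_le_nhds).and
    ((h1.filter_mono nhdsWithin_le_nhds).and ((h2.filter_mono nhdsWithin_le_nhds).and h3))).exists
  have hσ1 : ∀ i, σ i = i := by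
    intro i
    refine h6 h7 (show (G r (σ i)).1 = (G r i).1 from ?_)
    have h8 : (G r ∘ σ) i = G r i := congrFun (h5.symm.trans h4) i
    exact congrArg Prod.fst h8
  filter_upwards [hσ] with t ht
  rw [ht]
  funext i
  simp [hσ1 i]

end IsEigenSystemAt

/-- Global eigensystems exist. -/
theorem exists_global_isEigenSystem (hn : 0 < n) (hA : ∀ t, C.MemAt A t)
    (hnormal : ∀ t, A t * (A t)ᴴ = (A t)ᴴ * A t)
    (hnf : IsNormallyNonflat n (fun t => (A t).charpoly)) :
    ∃ (s : ℕ) (F : ℝ → Fin s → ℂ × Matrix (Fin n) (Fin n) ℂ), ∀ t, IsEigenSystemAt C A F t := by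
  obtain ⟨ι, _, F₀, hF₀⟩ := exists_isEigenSystemAt hn (hA 0) hnormal (hnf 0)
  refine ⟨Fintype.card ι, exists_global_of_local (fun F G t h hFG => h.congr hFG)
    (fun F t h => h.eventually) (fun F G t hF hG h => hF.eventuallyEq_of_frequently hG h) ?_
    (hF₀.comp_equiv (Fintype.equivFin ι).symm)⟩
  intro t₀
  obtain ⟨κ, _, L, hL⟩ := exists_isEigenSystemAt hn (hA t₀) hnormal (hnf t₀)
  obtain ⟨ε, hε, hb⟩ := Metric.eventually_nhds_iff_ball.mp hL.eventually
  refine ⟨Metric.ball t₀ ε, Metric.isOpen_ball, (convex_ball _ _).isPreconnected,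
    Metric.mem_ball_self hε, fun t₁ ht₁ G hG => ?_⟩
  obtain ⟨σ, hσ⟩ := hG.exists_equiv (hb t₁ ht₁)
  exact ⟨fun t => L t ∘ σ, fun t ht => (hb t ht).comp_equiv σ, hσ.symm⟩

end Relabeling

/-! ### Multiplicities and the global parameterization -/

section Global

open Polynomial Matrix FunctionClass

variable {n : ℕ} {ι : Type*} [Fintype ι]

theorem IsEigenDecomposition.eq_sum {B : Matrix (Fin n) (Fin n) ℂ}
    {x : ι → ℂ × Matrix (Fin n) (Fin n) ℂ} (h : IsEigenDecomposition B x) :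
    B = ∑ i, (x i).1 • (x i).2 := by
  conv_lhs => rw [← mul_one B, ← h.2.2, Finset.mul_sum]
  exact Finset.sum_congr rfl fun i _ => (h.1 i).2.1

/-- A linear combination of mutually orthogonal projections with sum `1` is the product of the
rescalings of their ranges. -/
theorem det_sum_smul_proj {P : ι → Matrix (Fin n) (Fin n) ℂ} (hproj : ∀ i, IsOrthProj (P i))
    (horth : ∀ i j, i ≠ j → P i * P j = 0) (hsum : ∑ i, P i = 1) {m : ι → ℕ}
    (hm : ∀ i, (P i).trace = m i) (c : ι → ℂ) :
    (∑ i, c i • P i).det = ∏ i, c i ^ m i := by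
  classical
  have key : ∀ s : Finset ι, (1 + ∑ i ∈ s, (c i - 1) • P i).det = ∏ i ∈ s, c i ^ m i := by
    intro s
    induction s using Finset.induction_on with
    | empty => simp
    | insert a s ha ih =>
      have h1 : 1 + ∑ i ∈ insert a s, (c i - 1) • P i =
          (1 + (c a - 1) • P a) * (1 + ∑ i ∈ s, (c i - 1) • P i) := by
        have h2 : P a * ∑ i ∈ s, (c i - 1) • P i = 0 := by
          rw [Finset.mul_sum]
          refine Finset.sum_eq_zero fun i hi => ?_
          rw [mul_smul_comm, horth a i (by rintro rfl; exact ha hi), smul_zero]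
        rw [Finset.sum_insert ha, add_mul, one_mul, mul_add, mul_one, smul_mul_assoc, h2,
          smul_zero, add_zero]
        abel
      obtain ⟨k, hk, hdet⟩ := (hproj a).exists_trace_eq
      have hkm : k = m a := by
        rw [hm a] at hk
        exact_mod_cast hk.symm
      rw [h1, det_mul, ih, hdet, hkm, Finset.prod_insert ha]
  rw [← key Finset.univ]
  congr 1
  simp only [sub_smul, one_smul, Finset.sum_sub_distrib, hsum]
  abel

theorem IsEigenDecomposition.charpoly_eq {B : Matrix (Fin n) (Fin n) ℂ}
    {x : ι → ℂ × Matrix (Fin n) (Fin n) ℂ} (h : IsEigenDecomposition B x) {m : ι → ℕ}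
    (hm : ∀ i, (x i).2.trace = m i) : B.charpoly = ∏ i, (X - C (x i).1) ^ m i := by
  refine Polynomial.funext fun z => ?_
  have h1 : scalar (Fin n) z - B = ∑ i, (z - (x i).1) • (x i).2 := by
    simp only [sub_smul, Finset.sum_sub_distrib]
    rw [← Finset.smul_sum, h.2.2, ← h.eq_sum, scalar_apply, ← smul_one_eq_diagonal]
  rw [eval_charpoly, h1, det_sum_smul_proj (fun i => (h.1 i).1) h.2.1 h.2.2 hm, eval_prod]
  simp

theorem IsEigenDecomposition.rootMultiplicity_eq [DecidableEq ι] {B : Matrix (Fin n) (Fin n) ℂ}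
    {x : ι → ℂ × Matrix (Fin n) (Fin n) ℂ} (h : IsEigenDecomposition B x) {m : ι → ℕ}
    (hm : ∀ i, (x i).2.trace = m i) {κ : Fin n → ι}
    (hκ : ∀ i, Nat.card {a // κ a = i} = m i) (z : ℂ) :
    Nat.card {a // (x (κ a)).1 = z} = B.charpoly.rootMultiplicity z := by
  classical
  have h1 : B.charpoly = ∏ a, (X - C (x (κ a)).1) := by
    rw [h.charpoly_eq hm, ← Finset.prod_fiberwise Finset.univ κ]
    refine Finset.prod_congr rfl fun i _ => ?_
    rw [Finset.prod_congr rfl fun a ha => by rw [(Finset.mem_filter.mp ha).2], Finset.prod_const,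
      ← hκ i, Nat.card_eq_fintype_card, Fintype.card_subtype]
  rw [h1, ← count_roots, roots_prod _ _ (Monic.ne_zero (monic_prod_of_monic _ _ fun i _ =>
    monic_X_sub_C _))]
  simp only [roots_X_sub_C, Multiset.bind_singleton]
  rw [Multiset.count_map, Nat.card_eq_fintype_card, Fintype.card_subtype]
  simp only [eq_comm]
  rfl

/-- The eigenprojections of an eigendecomposition with distinct eigenvalues. -/
theorem IsEigenDecomposition.isEigenprojection {B : Matrix (Fin n) (Fin n) ℂ}
    {x : ι → ℂ × Matrix (Fin n) (Fin n) ℂ} (h : IsEigenDecomposition B x)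
    (hinj : Function.Injective fun i => (x i).1) (i : ι) :
    IsEigenprojection B (x i).1 (x i).2 := by
  refine ⟨(h.1 i).1, fun v => ⟨fun hv => ?_, fun hv => ?_⟩⟩
  · rw [← hv, mulVec_mulVec, (h.1 i).2.1, smul_mulVec]
  · have h1 : ∀ j, j ≠ i → (x j).2 *ᵥ v = 0 := by
      intro j hj
      have h2 : (x j).1 • ((x j).2 *ᵥ v) = (x i).1 • ((x j).2 *ᵥ v) := by
        rw [← smul_mulVec, ← h.mul_eq_smul j, ← mulVec_mulVec, hv, mulVec_smul]
      rw [← sub_eq_zero, ← sub_smul] at h2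
      exact (smul_eq_zero.mp h2).resolve_left (sub_ne_zero.mpr fun hc => hj (hinj hc))
    conv_rhs => rw [← one_mulVec v, ← h.2.2, sum_mulVec]
    exact (Finset.sum_eq_single_of_mem i (Finset.mem_univ i) fun j _ hj => h1 j hj).symm

theorem exists_fiber_card (m : ι → ℕ) (h : ∑ i, m i = n) :
    ∃ κ : Fin n → ι, ∀ i, Nat.card {a // κ a = i} = m i := by
  have e : (Σ i, Fin (m i)) ≃ Fin n := Fintype.equivFinOfCardEq (by simp [h])
  refine ⟨fun a => (e.symm a).1, fun i => ?_⟩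
  have e1 : {a // (e.symm a).1 = i} ≃ {y : Σ i, Fin (m i) // y.1 = i} :=
    e.symm.subtypeEquiv fun a => Iff.rfl
  rw [Nat.card_congr e1, Nat.card_congr (Equiv.sigmaSubtype i), Nat.card_eq_fintype_card,
    Fintype.card_fin]

end Global

theorem proposition5p2 (C : FunctionClass) (n : ℕ) (A : ℝ → Matrix (Fin n) (Fin n) ℂ)
    (hA : C.MemMatrixCurve A)
    (hnormal : ∀ t, A t * (A t).conjTranspose = (A t).conjTranspose * A t)
    (hnonflat : IsNormallyNonflat n fun t => (A t).charpoly) :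
    ∃ (s : ℕ) (μ : Fin s → ℝ → ℂ) (κ : Fin n → Fin s)
      (P : Fin s → ℝ → Matrix (Fin n) (Fin n) ℂ),
      (∀ j, C.MemCurve (μ j)) ∧
      (∀ j, C.MemMatrixCurve (P j)) ∧
      Function.Surjective κ ∧
      ParameterizesEigenvalues A (fun i => μ (κ i)) ∧
      (∀ t₀ : ℝ, ∀ᶠ t in 𝓝[≠] t₀, Function.Injective fun j => μ j t) ∧
      (∀ t : ℝ, (Function.Injective fun j => μ j t) →
        ∀ j, IsEigenprojection (A t) (μ j t) (P j t)) ∧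
      (∀ t : ℝ, (∀ j, IsOrthProj (P j t) ∧ A t * P j t = μ j t • P j t) ∧
        (∀ i j, i ≠ j → P i t * P j t = 0) ∧ ∑ j, P j t = 1) := by
  rcases n.eq_zero_or_pos with rfl | hn
  · refine ⟨0, Fin.elim0, Fin.elim0, Fin.elim0, fun j => j.elim0, fun j => j.elim0,
      fun j => j.elim0, fun t z => ?_, fun t₀ => ?_, fun t _ j => j.elim0,
      fun t => ⟨fun j => j.elim0, fun j => j.elim0, Subsingleton.elim _ _⟩⟩
    · simp only [Matrix.charpoly_isEmpty, Nat.card_of_isEmpty]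
      rw [← Polynomial.C_1, Polynomial.rootMultiplicity_C]
    · exact Filter.Eventually.of_forall fun t j => j.elim0
  obtain ⟨s, F, hF⟩ := exists_global_isEigenSystem hn (memMatrixCurve_iff.mp hA) hnormal hnonflat
  have hdec : ∀ t, IsEigenDecomposition (A t) (F t) := fun t => (hF t).decomposition.self_of_nhds
  have htr : ∀ j t, (F t j).2.trace = (F 0 j).2.trace := by
    intro j t
    have hloc : IsLocallyConstant fun t => (F t j).2.trace :=
      (IsLocallyConstant.iff_eventually_eq _).mpr fun t => eventually_trace_eq
        ((hF t).mem_proj j) (Filter.Eventually.of_forall fun t => ((hdec t).1 j).1)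
    exact hloc.apply_eq_of_preconnectedSpace t 0
  choose m hm _ using fun j => ((hdec 0).1 j).1.exists_trace_eq
  have hmt : ∀ t j, (F t j).2.trace = m j := fun t j => (htr j t).trans (hm j)
  have hsum : ∑ j, m j = n := by
    have h1 := congrArg Matrix.trace (hdec 0).2.2
    rw [Matrix.trace_sum, Matrix.trace_one, Fintype.card_fin] at h1
    simp only [hm] at h1
    exact_mod_cast h1
  have hpos : ∀ j, m j ≠ 0 := by
    intro j h0
    refine ((hdec 0).1 j).1.trace_ne_zero ((hdec 0).1 j).2.2 ?_
    rw [hm j, h0, Nat.cast_zero]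
  obtain ⟨κ, hκ⟩ := exists_fiber_card m hsum
  refine ⟨s, fun j t => (F t j).1, κ, fun j t => (F t j).2,
    fun j => memCurve_iff.mpr fun t => (hF t).mem_value j,
    fun j => memMatrixCurve_iff.mpr fun t => (hF t).mem_proj j, fun j => ?_,
    fun t z => (hdec t).rootMultiplicity_eq (hmt t) hκ z, fun t₀ => (hF t₀).injective,
    fun t hinj j => (hdec t).isEigenprojection hinj j,
    fun t => ⟨fun j => ⟨((hdec t).1 j).1, ((hdec t).1 j).2.1⟩, (hdec t).2.1, (hdec t).2.2⟩⟩
  have hne : Nonempty {a // κ a = j} := by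
    by_contra hemp
    rw [not_nonempty_iff] at hemp
    exact hpos j (by rw [← hκ j, Nat.card_of_isEmpty])
  obtain ⟨a, ha⟩ := hne
  exact ⟨a, ha⟩
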